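/- **Dependency grammars.** A dependency grammar $G=\langle Lex,C,\mathrm{isa}_C,\Sigma\rangle$ consists of a finite alphabet $\Sigma$ of words, a finite set $C$ of word classes, a finite set of pairs in $C\times C$ whose reflexive–transitive closure $\mathrm{isa}_C$ is a partial order, and a lexicon $Lex$ that assigns to each word a set of classes. Each class $c\in C$ has a finite set of valencies $\langle b,d,c'\rangle$ ($b\in\{+,-\}$, $d$ a dependency name, $c'\in C$) and a non-empty finite sequence of order domains; each order domain carries a set of precedence restrictions $(l\prec l')$ between labels (dependency names or $\mathrm{self}$), and may be marked as admitting at most one partial dependency tree. A string $\sigma=w_1\cdots w_n$ belongs to $L(G)$ iff there are: a class from $Lex(w_i)$ for each occurrence $w_i$; a rooted tree on the occurrences with edges labelled by dependency names, each $h$ having at most one modifier in each dependency $d$; a choice, for each occurrence, of one of its own order domains in which it stands (with label $\mathrm{self}$); and an order domain into which each non-root occurrence is inserted (with the name of the dependency to its head as label), such that * if $h$ governs $m$ in dependency $d$, then the class of $h$ has a valency $\langle b,d,c\rangle$ with (class of $m$) $\mathrm{isa}_C\ c$, and $m$ is inserted into an order domain of $h$ or, only if $b=+$, of a transitive head of $h$;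 * let the content of a domain consist of its owner, if it stands there, and of every inserted occurrence together with the contents of the latter's domains. Then every content is an interval of $\sigma$, and the content of an earlier domain in the sequence of a word precedes that of a later one; * in each domain the words standing or inserted directly in it satisfy the precedence restrictions of the domain, and there is at most one of them if the domain is so marked. A valency is *continuous* if $b=-$. $DGR$ is the set of all $\langle G,\sigma\rangle$ with $G$ a dependency grammar, $\sigma\in\Sigma^+$ and $\sigma\in L(G)$. **Vertex cover.** An instance is $\langle V,E,k\rangle$ with a finite graph $\langle V,E\rangle$, $V=\{v_1,\dots,v_{|V|}\}$, $E=\{e_1,\dots,e_{|E|}\}$, and $k\in\mathbb N$, $k<|V|$. It is in $VC$ iff there are $V'\subseteq V$ with $|V'|\le k$ and $f:E\to V'$ such that $f(e)$ is an end point of $e$ for all $e\in E$. **Construction.** Let $\Sigma=\{s,v_1,\dots,v_{|V|}\}$ and $C=\{S,R,U\}\cup\{H_j\mid 1\le j\le|E|\}\cup\{U_i,V_i\mid 1\le i\le|V|\}$, with $U_i\ \mathrm{isa}_C\ U$ and $V_i\ \mathrm{isa}_C\ R$. Let $Lex(s)=\{S\}$ and $Lex(v_i)=\{U_i,V_i\}\cup\{H_j\mid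 v_i\text{ is an end point of }e_j\}$. Every class has a single order domain without restrictions. If $k\ge1$, the valencies of $S$ are $\langle -,u_a,U\rangle$ $(1\le a\le |V|-k)$, $\langle -,h_j,H_j\rangle$ $(1\le j\le|E|)$ and $\langle -,r_b,R\rangle$ $(1\le b\le(k-1)|E|)$; if $k=0$, $S$ has no valencies. The valencies of $U_i$ are $\langle -,r_b,V_i\rangle$ $(1\le b\le|E|-1)$. The other classes have no valencies. Let $G(V,E,k)$ be the resulting grammar and $\sigma(V,E,k)=s\,v_1^{|E|}\cdots v_{|V|}^{|E|}$. **Lemma.** The map $\langle V,E,k\rangle\mapsto\langle G(V,E,k),\sigma(V,E,k)\rangle$ is computable by a Turing machine in time polynomial in the length of the encoding of $\langle V,E,k\rangle$ (as a bit string, with indices written in unary). For every instance $\langle V,E,k\rangle$, $G(V,E,k)$ is a dependency grammar all of whose valencies are continuous, $\sigma(V,E,k)$ is a non-empty string over its alphabet, and $$\langle V,E,k\rangle\in VC\iff\langle G(V,E,k),\sigma(V,E,k)\rangle\in DGR .$$ -/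

import Mathlib

/-! ### Dependency grammars with word order domains

Words, word classes and dependency names are symbols, represented by natural numbers. -/

/-- An order domain of a word class. `single` says that the domain may hold at most one partial
dependency tree. `prec` is the precedence relation `≺` on dependency labels: `some d` stands for the
dependency name `d`, and `none` for the special symbol `self`, which denotes the head. -/
structure DomainSpec where
  single : Bool
  prec : List (Option ℕ × Option ℕ)

/-- A valency `⟨b, d, c⟩`: `discont` is the flag `b` (`true` for `+`, `false` for `-`), `dep` the
dependency name, `cls` the required class of the modifier. -/
structure Valency where
  discont : Bool
  dep : ℕ
  cls : ℕ

/-- A word class with its valencies and its sequence of order domains. -/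
structure WordClass where
  name : ℕ
  valencies : List Valency
  domains : List DomainSpec

/-- A dependency grammar `⟨Lex, C, isa_C, Σ⟩`. The lexicon is given by its pairs (word, class),
the subclass hierarchy by pairs (subclass, superclass). -/
structure DepGrammar where
  lex : List (ℕ × ℕ)
  classes : List WordClass
  isa : List (ℕ × ℕ)
  alphabet : List ℕ

namespace DepGrammar

/-- The names of the word classes of `G`. -/
def classNames (G : DepGrammar) : List ℕ := G.classes.map WordClass.name

/-- `a isa_C b`: the reflexive and transitive closure of the given subclass pairs. -/
def Isa (G : DepGrammar) : ℕ → ℕ → Prop :=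
  Relation.ReflTransGen fun a b => (a, b) ∈ G.isa

/-- The components of `G` fit together: every class is declared once and has at least one order
domain, all symbols that are used are declared, and the subclass relation is a partial order. -/
structure WellFormed (G : DepGrammar) : Prop where
  nodup : G.classNames.Nodup
  lex_mem : ∀ p ∈ G.lex, p.1 ∈ G.alphabet ∧ p.2 ∈ G.classNames
  isa_mem : ∀ p ∈ G.isa, p.1 ∈ G.classNames ∧ p.2 ∈ G.classNames
  isa_antisymm : ∀ a b, G.Isa a b → G.Isa b a → a = b
  valency_mem : ∀ c ∈ G.classes, ∀ v ∈ c.valencies, v.cls ∈ G.classNames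
  domains_ne : ∀ c ∈ G.classes, c.domains ≠ []

/-- All valencies of `G` are continuous (have the flag `-`). -/
def OnlyContinuous (G : DepGrammar) : Prop :=
  ∀ c ∈ G.classes, ∀ v ∈ c.valencies, v.discont = false

end DepGrammar

/-- The raw data of a dependency analysis of a string of `n` words: for every position its reading
(a word class), its head and the name of the dependency to the head (`none` for the root), the
index of the word's own order domain in which the word itself stands, and, for a word that is not
the root, the word (`host`) and the index of that word's order domain (`hostDom`) into which it is
inserted. -/
structure Analysis (n : ℕ) where
  reading : Fin n → WordClass
  gov : Fin n → Option (Fin n × ℕ)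
  selfDom : Fin n → ℕ
  host : Fin n → Fin n
  hostDom : Fin n → ℕ

namespace Analysis

variable {n : ℕ} (T : Analysis n)

/-- `h` is the (direct) head of `m`. -/
def Head (h m : Fin n) : Prop := ∃ d, T.gov m = some (h, d)

/-- `m` is not the root and is inserted into some order domain of `g`. -/
def Hosts (g m : Fin n) : Prop := T.gov m ≠ none ∧ T.host m = g

/-- The word `x` stands, with label `l`, directly in the `j`-th order domain of `g`: either `x` is
`g` itself (label `self`), or `x` was inserted there, and then its label is the name of the
dependency between `x` and its head. -/
def Stands (g : Fin n) (j : ℕ) (l : Option ℕ) (x : Fin n) : Prop :=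
  (l = none ∧ x = g ∧ T.selfDom g = j) ∨
    ∃ h d, T.gov x = some (h, d) ∧ T.host x = g ∧ T.hostDom x = j ∧ l = some d

/-- The set of words of the `j`-th order domain of `g`: the word `g`, if it stands there, and every
word inserted there, together with all words in the order domains of the latter. By definition two
order domains are disjoint or one includes the other. -/
def domain (g : Fin n) (j : ℕ) : Set (Fin n) :=
  {x | (x = g ∧ T.selfDom g = j) ∨
    ∃ m, T.gov m ≠ none ∧ T.host m = g ∧ T.hostDom m = j ∧ Relation.ReflTransGen T.Hosts m x}

/-- The head–modifier relation is a tree: there is a word without head from which every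
word is reached (each word has at most one head anyway). -/
def IsTree : Prop :=
  ∃ r, T.gov r = none ∧ ∀ m, Relation.ReflTransGen T.Head r m

/-- `governs(h, d, m)`: the class of `h` has a valency `⟨b, d, c⟩` such that `m` isa `c`, and `m` is
inserted into an existing order domain of `h` or, only if `b = +`, of a transitive head of `h`. -/
def Governs (G : DepGrammar) (h : Fin n) (d : ℕ) (m : Fin n) : Prop :=
  ∃ v ∈ (T.reading h).valencies, v.dep = d ∧ G.Isa (T.reading m).name v.cls ∧
    (T.host m = h ∨ (v.discont = true ∧ Relation.TransGen T.Head (T.host m) h)) ∧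
    T.hostDom m < (T.reading (T.host m)).domains.length

/-- The order domains are consistent with the linear order of the words. -/
structure OrderConsistent : Prop where
  /-- every word stands in one of its own order domains -/
  self_lt : ∀ g, T.selfDom g < (T.reading g).domains.length
  /-- words in a prior domain of `g` precede all words in a subsequent domain of `g` -/
  sequence : ∀ g i j, i < j → ∀ x ∈ T.domain g i, ∀ y ∈ T.domain g j, x < y
  /-- domains are projective: they are not interrupted by foreign words -/
  projective : ∀ g j x y z, x ∈ T.domain g j → z ∈ T.domain g j → x < y → y < z →
    y ∈ T.domain g j
  /-- a domain marked as `single` contains at most one partial dependency tree -/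
  single : ∀ g j D, (T.reading g).domains[j]? = some D → D.single = true →
    ∀ l x l' x', T.Stands g j l x → T.Stands g j l' x' → x = x'
  /-- the precedence restrictions of a domain hold between the words that stand in it -/
  prec : ∀ g j D, (T.reading g).domains[j]? = some D → ∀ p ∈ D.prec,
    ∀ x y, T.Stands g j p.1 x → T.Stands g j p.2 y → x < y

/-- `T` is a dependency analysis of the string `σ` under the grammar `G`. -/
structure Valid (G : DepGrammar) (σ : List ℕ) (T : Analysis σ.length) : Prop where
  reading_mem : ∀ i, T.reading i ∈ G.classes ∧ (σ.get i, (T.reading i).name) ∈ G.lex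
  tree : T.IsTree
  /-- a word has at most one modifier for each dependency name -/
  mod_unique : ∀ h d m m', T.gov m = some (h, d) → T.gov m' = some (h, d) → m = m'
  governs : ∀ h d m, T.gov m = some (h, d) → T.Governs G h d m
  order : T.OrderConsistent

end Analysis

/-- The language `L(G)`. -/
def DepGrammar.language (G : DepGrammar) : Language ℕ :=
  {σ | ∃ T : Analysis σ.length, Analysis.Valid G σ T}

/-- A pair of a grammar and an input string. -/
structure DGInstance where
  grammar : DepGrammar
  input : List ℕ

/-- `⟨G, σ⟩` is a possible instance of the recognition problem: `G` is a dependency grammar and `σ`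
is a non-empty string over the alphabet of `G`. -/
def DGInstance.IsPossible (x : DGInstance) : Prop :=
  x.grammar.WellFormed ∧ x.input ≠ [] ∧ ∀ w ∈ x.input, w ∈ x.grammar.alphabet

/-- The recognition problem for dependency grammars. -/
def DGR : Set DGInstance :=
  {x | x.IsPossible ∧ x.input ∈ x.grammar.language}

/-! ### The vertex cover problem -/

/-- A possible instance `⟨V, E, k⟩` of the vertex cover problem: the vertices are
`0, …, numV - 1`, the finite set `E` of pairs is given by a list without repetition, and `k < |V|`.
Loops are allowed. -/
structure VCInstance where
  numV : ℕ
  edges : List (ℕ × ℕ)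
  k : ℕ
  nodup : edges.Nodup
  edges_lt : ∀ e ∈ edges, e.1 < numV ∧ e.2 < numV
  k_lt : k < numV

/-- The vertex cover problem. -/
def VC : Set VCInstance :=
  {I | ∃ V' : Finset ℕ, V' ⊆ Finset.range I.numV ∧ V'.card ≤ I.k ∧
    ∃ f : {e // e ∈ I.edges} → {v // v ∈ V'}, ∀ e, (f e : ℕ) = e.1.1 ∨ (f e : ℕ) = e.1.2}

/-! ### Encodings as bit strings

Numbers (indices) are written in unary and lists element by element, each element
preceded by `true`, with a final `false`. -/

def encNat (a : ℕ) : List Bool := List.replicate a true ++ [false]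

def encList {α : Type} (f : α → List Bool) : List α → List Bool
  | [] => [false]
  | a :: l => true :: (f a ++ encList f l)

def encPair {α β : Type} (f : α → List Bool) (g : β → List Bool) (p : α × β) : List Bool :=
  f p.1 ++ g p.2

def encOption {α : Type} (f : α → List Bool) : Option α → List Bool
  | none => [false]
  | some a => true :: f a

def DomainSpec.encode (D : DomainSpec) : List Bool :=
  D.single :: encList (encPair (encOption encNat) (encOption encNat)) D.prec

def Valency.encode (v : Valency) : List Bool :=
  v.discont :: (encNat v.dep ++ encNat v.cls)

def WordClass.encode (c : WordClass) : List Bool :=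
  encNat c.name ++ (encList Valency.encode c.valencies ++ encList DomainSpec.encode c.domains)

def DepGrammar.encode (G : DepGrammar) : List Bool :=
  encList (encPair encNat encNat) G.lex ++ (encList WordClass.encode G.classes ++
    (encList (encPair encNat encNat) G.isa ++ encList encNat G.alphabet))

def DGInstance.encode (x : DGInstance) : List Bool :=
  x.grammar.encode ++ encList encNat x.input

def VCInstance.encode (I : VCInstance) : List Bool :=
  encNat I.numV ++ (encList (encPair encNat encNat) I.edges ++ encNat I.k)

/-! The encodings are uniquely readable. -/

/-- `f` is injective and no code word is a proper prefix of another one. -/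
def UniquelyReadable {α : Type} (f : α → List Bool) : Prop :=
  ∀ a b s t, f a ++ s = f b ++ t → a = b ∧ s = t

theorem uniquelyReadable_encNat : UniquelyReadable encNat := by
  intro a
  induction a with
  | zero => intro b s t h; cases b <;> simp_all [encNat, List.replicate_succ]
  | succ a ih =>
    intro b s t h
    cases b with
    | zero => simp [encNat, List.replicate_succ] at h
    | succ b =>
      have := ih b s t (by simpa [encNat, List.replicate_succ] using h)
      exact ⟨by rw [this.1], this.2⟩

theorem uniquelyReadable_encList {α : Type} {f : α → List Bool} (hf : UniquelyReadable f) :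
    UniquelyReadable (encList f) := by
  intro a
  induction a with
  | nil => intro b s t h; cases b <;> simp_all [encList]
  | cons x a ih =>
    intro b s t h
    cases b with
    | nil => simp [encList] at h
    | cons y b =>
      simp only [encList, List.cons_append, List.append_assoc, List.cons.injEq, true_and] at h
      replace h := hf _ _ _ _ h
      obtain ⟨rfl, h⟩ := h
      replace h := ih _ _ _ h
      obtain ⟨rfl, h⟩ := h
      exact ⟨rfl, h⟩

theorem uniquelyReadable_encPair {α β : Type} {f : α → List Bool} {g : β → List Bool}
    (hf : UniquelyReadable f) (hg : UniquelyReadable g) : UniquelyReadable (encPair f g) := by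
  rintro ⟨a, b⟩ ⟨a', b'⟩ s t h
  simp only [encPair, List.append_assoc] at h
  replace h := hf _ _ _ _ h
  obtain ⟨rfl, h⟩ := h
  replace h := hg _ _ _ _ h
  obtain ⟨rfl, h⟩ := h
  exact ⟨rfl, h⟩

theorem uniquelyReadable_encOption {α : Type} {f : α → List Bool} (hf : UniquelyReadable f) :
    UniquelyReadable (encOption f) := by
  rintro (_ | a) (_ | b) s t h <;> simp only [encOption, List.cons_append, List.nil_append,
    List.cons.injEq, reduceCtorEq, true_and, false_and] at h
  · exact ⟨rfl, h⟩
  · replace h := hf _ _ _ _ h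
    obtain ⟨rfl, h⟩ := h
    exact ⟨rfl, h⟩

theorem DomainSpec.uniquelyReadable_encode : UniquelyReadable DomainSpec.encode := by
  rintro ⟨a, b⟩ ⟨a', b'⟩ s t h
  simp only [DomainSpec.encode, List.cons_append, List.cons.injEq] at h
  have hn := uniquelyReadable_encOption uniquelyReadable_encNat
  obtain ⟨rfl, h⟩ := h
  replace h := uniquelyReadable_encList (uniquelyReadable_encPair hn hn) _ _ _ _ h
  obtain ⟨rfl, h⟩ := h
  exact ⟨rfl, h⟩

theorem Valency.uniquelyReadable_encode : UniquelyReadable Valency.encode := by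
  rintro ⟨a, b, c⟩ ⟨a', b', c'⟩ s t h
  simp only [Valency.encode, List.cons_append, List.append_assoc, List.cons.injEq] at h
  obtain ⟨rfl, h⟩ := h
  replace h := uniquelyReadable_encNat _ _ _ _ h
  obtain ⟨rfl, h⟩ := h
  replace h := uniquelyReadable_encNat _ _ _ _ h
  obtain ⟨rfl, h⟩ := h
  exact ⟨rfl, h⟩

theorem WordClass.uniquelyReadable_encode : UniquelyReadable WordClass.encode := by
  rintro ⟨a, b, c⟩ ⟨a', b', c'⟩ s t h
  simp only [WordClass.encode, List.append_assoc] at h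
  replace h := uniquelyReadable_encNat _ _ _ _ h
  obtain ⟨rfl, h⟩ := h
  replace h := uniquelyReadable_encList Valency.uniquelyReadable_encode _ _ _ _ h
  obtain ⟨rfl, h⟩ := h
  replace h := uniquelyReadable_encList DomainSpec.uniquelyReadable_encode _ _ _ _ h
  obtain ⟨rfl, h⟩ := h
  exact ⟨rfl, h⟩

theorem DGInstance.uniquelyReadable_encode : UniquelyReadable DGInstance.encode := by
  rintro ⟨⟨a, b, c, d⟩, e⟩ ⟨⟨a', b', c', d'⟩, e'⟩ s t h
  simp only [DGInstance.encode, DepGrammar.encode, List.append_assoc] at h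
  have hn := uniquelyReadable_encNat
  replace h := uniquelyReadable_encList (uniquelyReadable_encPair hn hn) _ _ _ _ h
  obtain ⟨rfl, h⟩ := h
  replace h := uniquelyReadable_encList WordClass.uniquelyReadable_encode _ _ _ _ h
  obtain ⟨rfl, h⟩ := h
  replace h := uniquelyReadable_encList (uniquelyReadable_encPair hn hn) _ _ _ _ h
  obtain ⟨rfl, h⟩ := h
  replace h := uniquelyReadable_encList hn _ _ _ _ h
  obtain ⟨rfl, h⟩ := h
  replace h := uniquelyReadable_encList hn _ _ _ _ h
  obtain ⟨rfl, h⟩ := h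
  exact ⟨rfl, h⟩

theorem VCInstance.uniquelyReadable_encode : UniquelyReadable VCInstance.encode := by
  rintro ⟨a, b, c, _, _, _⟩ ⟨a', b', c', _, _, _⟩ s t h
  simp only [VCInstance.encode, List.append_assoc] at h
  have hn := uniquelyReadable_encNat
  replace h := hn _ _ _ _ h
  obtain ⟨rfl, h⟩ := h
  replace h := uniquelyReadable_encList (uniquelyReadable_encPair hn hn) _ _ _ _ h
  obtain ⟨rfl, h⟩ := h
  replace h := hn _ _ _ _ h
  obtain ⟨rfl, h⟩ := h
  exact ⟨rfl, h⟩

/-! ### The grammar and the string built from a vertex cover instance -/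

namespace VCInstance

/-- The word `s`. -/
def wordS : ℕ := 0

/-- The word of the vertex `i`. -/
def wordV (i : ℕ) : ℕ := i + 1

/-- The names of the word classes `S`, `R`, `U`, `H_j`, `U_i` and `V_i`. -/
def clsS : ℕ := 0
def clsR : ℕ := 1
def clsU : ℕ := 2
def clsH (j : ℕ) : ℕ := 3 * j + 3
def clsUi (i : ℕ) : ℕ := 3 * i + 4
def clsVi (i : ℕ) : ℕ := 3 * i + 5

/-- The dependency names `u_a`, `h_j` and `r_b`. -/
def depU (a : ℕ) : ℕ := 3 * a
def depH (j : ℕ) : ℕ := 3 * j + 1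
def depR (b : ℕ) : ℕ := 3 * b + 2

variable (I : VCInstance)

/-- The number `|E|` of edges. -/
def numE : ℕ := I.edges.length

/-- The word class with the given name and valencies whose sequence of order domains consists of a
single domain, which is not restricted in size and has no precedence restrictions. -/
def freeClass (name : ℕ) (valencies : List Valency) : WordClass :=
  ⟨name, valencies, [⟨false, []⟩]⟩

/-- The valencies of `S`: `|V| - k` of class `U`, one of class `H_j` for each edge `e_j`, and
`(k - 1) * |E|` of class `R`. This is meant for `k ≥ 1`; for `k = 0`, where the last number would
be negative, `S` has no valencies. -/
def valenciesS : List Valency :=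
  if I.k = 0 then [] else
    (List.range (I.numV - I.k)).map (fun a => ⟨false, depU a, clsU⟩) ++
    (List.range I.numE).map (fun j => ⟨false, depH j, clsH j⟩) ++
    (List.range ((I.k - 1) * I.numE)).map (fun b => ⟨false, depR b, clsR⟩)

/-- The valencies of `U_i`: `|E| - 1` of class `V_i`. -/
def valenciesUi (i : ℕ) : List Valency :=
  (List.range (I.numE - 1)).map fun b => ⟨false, depR b, clsVi i⟩

/-- The grammar `G(V, E, k)`. -/
def grammar : DepGrammar where
  lex := (wordS, clsS) ::
    ((List.range I.numV).flatMap (fun i => [(wordV i, clsUi i), (wordV i, clsVi i)]) ++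
     I.edges.zipIdx.flatMap (fun p => [(wordV p.1.1, clsH p.2), (wordV p.1.2, clsH p.2)]))
  classes := [freeClass clsS I.valenciesS, freeClass clsR [], freeClass clsU []] ++
    (List.range I.numE).map (fun j => freeClass (clsH j) []) ++
    (List.range I.numV).map (fun i => freeClass (clsUi i) (I.valenciesUi i)) ++
    (List.range I.numV).map (fun i => freeClass (clsVi i) [])
  isa := (List.range I.numV).flatMap fun i => [(clsUi i, clsU), (clsVi i, clsR)]
  alphabet := wordS :: (List.range I.numV).map wordV

/-- The string `σ(V, E, k)`, which is `s` followed by `|E|` copies of each vertex. -/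
def string : List ℕ :=
  wordS :: (List.range I.numV).flatMap fun i => List.replicate I.numE (wordV i)

/-- The instance `⟨G(V, E, k), σ(V, E, k)⟩` of the recognition problem. -/
def toDG : DGInstance := ⟨I.grammar, I.string⟩

end VCInstance

/-!
# The reduction of vertex cover to the recognition problem for dependency grammars

**Correctness of the reduction.** Let `V'` be a vertex cover of size exactly `k` (a smaller one can
be enlarged, as `k < |V|`), and let `g j ∈ V'` be the end point chosen for the edge with index `j`.
Among the `|E|` copies of a vertex `i ∈ V'`, the copy with number `j` is read as `H_j` if `g j = i`;
the other `(k - 1) * |E|` copies of vertices in `V'` are read as `V_i`. All of them are governed by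
`s`. For a vertex outside `V'`, the first copy is read as `U_i`, is governed by `s`, and governs the
other `|E| - 1` copies. As the copies of a vertex are adjacent, all domains are
intervals (`IsCover.valid_analysis`).

Conversely, in an analysis of the string, `s` is the root, and every other word is governed by `s`
or by an occurrence of the same vertex with the reading `U_i`, which itself is governed by `s` in
some dependency `u_a` (`gov_cases`). So call a vertex skipped if one of its occurrences is governed
by `s` in some `u_a`; at most `|V| - k` vertices are skipped (`card_isSkipped_le`). Let `V'` be the
set of the other vertices. All `|V'| * |E| ≥ k * |E|` occurrences of vertices in `V'` are governed
by `s` in pairwise different dependencies `h_j` or `r_b` (`isSkipped_or_gov`), of which there are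
only `|E| + (k - 1) * |E| = k * |E|`. Hence `|V'| ≤ k` and every `h_j` is used, that is, every edge has
an end point in `V'` (`mem_VC_of_mem_language`). The valencies of the classes `U_i` need not be
counted for this.

**Computability.** Apart from reading its input, the reduction only prints nested lists whose
entries are numbers that depend linearly on loop indices. A small programming language `Prog` with
counting loops expresses this. Its programs are compiled into stack machines (`Prog.code`), and
`Prog.Runs` states what a program does as part of any such machine, with one rule for each
construct.
A register that bounds a loop is never raised above the length `N` of the input, so the nesting of
loops alone gives a polynomial time bound `Prog.bound`. What is left is to write the program
(`VCInstance.program`) and to follow its output (`VCInstance.exec_program`).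
-/

/-! ### A small language of printing programs and its implementation by stack machines -/

/-- Programs over registers `K` holding natural numbers, with a one-way input of bits and a
write-only output. `dec` truncates at `0`. `ifPos r p` runs `p` once if `r` is positive.
`loop r p` repeats "decrement `r`, then run `p`" until `r` is `0`. `read p` consumes input bits,
runs `p` after each bit `true`, and stops after the first bit `false`; since `p` may itself consume
input, this is the control structure that parses an `encList` code. -/
inductive Prog (K : Type)
  | emit (w : List Bool)
  | inc (r : K)
  | dec (r : K)
  | seq (p q : Prog K)
  | ifPos (r : K) (p : Prog K)
  | loop (r : K) (p : Prog K)
  | read (p : Prog K)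

namespace Prog

open Turing TM2 Polynomial

variable {K : Type}

/-- The control points of a program. -/
def Label : Prog K → Type
  | emit _ => Unit
  | inc _ => Unit
  | dec _ => Unit
  | seq p q => Label p ⊕ Label q
  | ifPos _ p => Option (Label p)
  | loop _ p => Option (Label p)
  | read p => Option (Label p)

/-- A program has finitely many control points. -/
@[reducible]
def labelFintype : ∀ p : Prog K, Fintype (Label p)
  | emit _ => inferInstanceAs (Fintype Unit)
  | inc _ => inferInstanceAs (Fintype Unit)
  | dec _ => inferInstanceAs (Fintype Unit)
  | seq p q =>
    letI := labelFintype p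
    letI := labelFintype q
    inferInstanceAs (Fintype (Label p ⊕ Label q))
  | ifPos _ p => letI := labelFintype p; inferInstanceAs (Fintype (Option (Label p)))
  | loop _ p => letI := labelFintype p; inferInstanceAs (Fintype (Option (Label p)))
  | read p => letI := labelFintype p; inferInstanceAs (Fintype (Option (Label p)))

instance (p : Prog K) : Fintype (Label p) := labelFintype p

/-- The control point at which a program starts. -/
def entry : ∀ p : Prog K, Label p
  | emit _ => ()
  | inc _ => ()
  | dec _ => ()
  | seq p _ => Sum.inl (entry p)
  | ifPos _ _ => none
  | loop _ _ => none
  | read _ => none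

/-- Machine statements over the stacks `inl false` (the input), `inl true` (the output) and `inr r`
(the register `r`). The internal memory holds the bit popped last; it is `none` at every label. -/
abbrev Code (K Λ : Type) := Stmt (fun _ : Bool ⊕ K => Bool) Λ (Option Bool)

/-- The statement at a control point of a program that is part of a larger machine: `emb` embeds
the control points into the labels of that machine, which continues at `exit`. -/
def code {Λ : Type} : ∀ p : Prog K, (Label p → Λ) → Λ → Label p → Code K Λ
  | emit w, _, exit, _ =>
    w.foldr (fun b q => .push (.inl true) (fun _ => b) q) (.goto fun _ => exit)
  | inc r, _, exit, _ => .push (.inr r) (fun _ => true) (.goto fun _ => exit)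
  | dec r, _, exit, _ => .pop (.inr r) (fun v _ => v) (.goto fun _ => exit)
  | seq p q, emb, _, .inl l => code p (emb ∘ Sum.inl) (emb (.inr (entry q))) l
  | seq _ q, emb, exit, .inr l => code q (emb ∘ Sum.inr) exit l
  | ifPos r p, emb, exit, none => .peek (.inr r) (fun _ h => h)
      (.branch Option.isSome (.load (fun _ => none) (.goto fun _ => emb (some (entry p))))
        (.goto fun _ => exit))
  | ifPos _ p, emb, exit, some l => code p (emb ∘ some) exit l
  | loop r p, emb, exit, none => .pop (.inr r) (fun _ h => h)
      (.branch Option.isSome (.load (fun _ => none) (.goto fun _ => emb (some (entry p))))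
        (.goto fun _ => exit))
  | loop _ p, emb, _, some l => code p (emb ∘ some) (emb none) l
  | read p, emb, exit, none => .pop (.inl false) (fun _ h => h)
      (.branch (fun v => v == some true)
        (.load (fun _ => none) (.goto fun _ => emb (some (entry p))))
        (.load (fun _ => none) (.goto fun _ => exit)))
  | read p, emb, _, some l => code p (emb ∘ some) (emb none) l

/-- The stack contents that represent an input, an output (last bit on top) and register values
(in unary). -/
def stackVals (i o : List Bool) (c : K → ℕ) : Bool ⊕ K → List Bool
  | .inl false => i
  | .inl true => o
  | .inr r => List.replicate (c r) true

variable [DecidableEq K]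

theorem update_stackVals_input (i o i' : List Bool) (c : K → ℕ) :
    Function.update (stackVals i o c) (.inl false) i' = stackVals i' o c := by
  funext x
  rcases x with (_ | _) | r <;> simp [stackVals]

theorem update_stackVals_output (i o o' : List Bool) (c : K → ℕ) :
    Function.update (stackVals i o c) (.inl true) o' = stackVals i o' c := by
  funext x
  rcases x with (_ | _) | r <;> simp [stackVals]

theorem update_stackVals_register (i o : List Bool) (c : K → ℕ) (r : K) (n : ℕ) :
    Function.update (stackVals i o c) (.inr r) (List.replicate n true) =
      stackVals i o (Function.update c r n) := by
  funext x
  rcases x with (_ | _) | s <;> simp [stackVals, Function.update_apply]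
  split_ifs <;> rfl

/-- The machine `M` goes from `a` to `b` in exactly `t` steps. -/
def Steps {Λ : Type} (M : Λ → Code K Λ) (t : ℕ)
    (a b : Cfg (fun _ : Bool ⊕ K => Bool) Λ (Option Bool)) : Prop :=
  (flip bind (TM2.step M))^[t] (some a) = some b

theorem Steps.trans {Λ : Type} {M : Λ → Code K Λ} {t u : ℕ}
    {a b d : Cfg (fun _ : Bool ⊕ K => Bool) Λ (Option Bool)} (h : Steps M t a b)
    (h' : Steps M u b d) : Steps M (t + u) a d := by
  unfold Steps at *
  rw [Nat.add_comm, Function.iterate_add_apply, h, h']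

theorem Steps.one {Λ : Type} {M : Λ → Code K Λ} {l : Λ} {v : Option Bool}
    {S : Bool ⊕ K → List Bool} {s : Code K Λ} {b} (hl : M l = s) (h : stepAux s v S = b) :
    Steps M 1 ⟨some l, v, S⟩ b := by
  subst hl h; rfl

/-- `Runs T p i c i' c' w`: from the input `i` and the register values `c`, the program `p`, as
part of any machine, reaches its end with the input `i'` left and with register values `c'`, has
written `w`, and needs at most `T` steps for this. The bound `T` also applies to the length
of `w`. -/
def Runs (T : ℕ) (p : Prog K) (i : List Bool) (c : K → ℕ) (i' : List Bool) (c' : K → ℕ)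
    (w : List Bool) : Prop :=
  w.length ≤ T ∧ ∀ (Λ : Type) (M : Λ → Code K Λ) (emb : Label p → Λ) (exit : Λ),
    (∀ l, M (emb l) = code p emb exit l) → ∀ o, ∃ t ≤ T,
      Steps M t ⟨some (emb (entry p)), none, stackVals i o c⟩
        ⟨some exit, none, stackVals i' (w.reverse ++ o) c'⟩

variable {T U : ℕ} {p q : Prog K} {i i' i'' : List Bool} {c c' c'' : K → ℕ} {r : K}
  {w w' : List Bool}

theorem Runs.mono (h : Runs T p i c i' c' w) (hT : T ≤ U) : Runs U p i c i' c' w :=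
  ⟨h.1.trans hT, fun Λ M emb exit hM o =>
    let ⟨t, ht, hs⟩ := h.2 Λ M emb exit hM o
    ⟨t, ht.trans hT, hs⟩⟩

theorem Runs.emit (w : List Bool) (i : List Bool) (c : K → ℕ) :
    Runs (w.length + 1) (emit w) i c i c w := by
  refine ⟨by simp, fun Λ M emb exit hM o => ⟨1, by simp, Steps.one (hM ()) ?_⟩⟩
  change stepAux (w.foldr (fun b q => .push (.inl true) (fun _ => b) q) (.goto fun _ => exit))
    none (stackVals i o c) = _
  clear hM emb
  induction w generalizing o with
  | nil => simp
  | cons b w ih =>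
    simp only [List.foldr_cons, stepAux, update_stackVals_output]
    rw [show stackVals i o c (.inl true) = o from rfl, ih]
    simp

theorem Runs.inc (r : K) (i : List Bool) (c : K → ℕ) :
    Runs 1 (inc r) i c i (Function.update c r (c r + 1)) [] := by
  refine ⟨by simp, fun Λ M emb exit hM o => ⟨1, le_rfl, Steps.one (hM ()) ?_⟩⟩
  simp only [code, stepAux, stackVals, ← List.replicate_succ, update_stackVals_register,
    List.reverse_nil, List.nil_append]

theorem Runs.dec (r : K) (i : List Bool) (c : K → ℕ) :
    Runs 1 (dec r) i c i (Function.update c r (c r - 1)) [] := by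
  refine ⟨by simp, fun Λ M emb exit hM o => ⟨1, le_rfl, Steps.one (hM ()) ?_⟩⟩
  simp only [code, stepAux, stackVals, List.tail_replicate, update_stackVals_register,
    List.reverse_nil, List.nil_append]

theorem Runs.seq (h : Runs T p i c i' c' w) (h' : Runs U q i' c' i'' c'' w') :
    Runs (T + U) (p.seq q) i c i'' c'' (w ++ w') := by
  refine ⟨by simpa using Nat.add_le_add h.1 h'.1, fun Λ M emb exit hM o => ?_⟩
  obtain ⟨t, ht, hs⟩ := h.2 Λ M (emb ∘ Sum.inl) (emb (.inr (entry q)))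
    (fun l => hM (.inl l)) o
  obtain ⟨u, hu, hs'⟩ := h'.2 Λ M (emb ∘ Sum.inr) exit (fun l => hM (.inr l)) (w.reverse ++ o)
  refine ⟨t + u, Nat.add_le_add ht hu, ?_⟩
  rw [List.reverse_append, List.append_assoc]
  exact hs.trans hs'

theorem Runs.ifPos_zero (hr : c r = 0) : Runs 1 (ifPos r p) i c i c [] := by
  refine ⟨by simp, fun Λ M emb exit hM o => ⟨1, le_rfl, Steps.one (hM none) ?_⟩⟩
  simp [code, stackVals, hr]

theorem Runs.ifPos_pos (hr : 0 < c r) (h : Runs T p i c i' c' w) :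
    Runs (T + 1) (ifPos r p) i c i' c' w := by
  refine ⟨h.1.trans (by simp), fun Λ M emb exit hM o => ?_⟩
  obtain ⟨t, ht, hs⟩ := h.2 Λ M (emb ∘ some) exit (fun l => hM (some l)) o
  refine ⟨1 + t, by lia, Steps.trans (Steps.one (hM none) ?_) hs⟩
  obtain ⟨n, hn⟩ := Nat.exists_eq_succ_of_ne_zero hr.ne'
  simp [code, stackVals, hn, List.replicate_succ]
  rfl

theorem Runs.loop_zero (hr : c r = 0) : Runs 1 (loop r p) i c i c [] := by
  refine ⟨by simp, fun Λ M emb exit hM o => ⟨1, le_rfl, Steps.one (hM none) ?_⟩⟩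
  simp [code, stepAux, stackVals, hr]

theorem Runs.loop_step (hr : 0 < c r)
    (h : Runs T p i (Function.update c r (c r - 1)) i' c' w)
    (h' : Runs U (loop r p) i' c' i'' c'' w') :
    Runs (T + U + 1) (loop r p) i c i'' c'' (w ++ w') := by
  refine ⟨by simpa using (Nat.add_le_add h.1 h'.1).trans (Nat.le_succ _),
    fun Λ M emb exit hM o => ?_⟩
  obtain ⟨t, ht, hs⟩ := h.2 Λ M (emb ∘ some) (emb none) (fun l => hM (some l)) o
  obtain ⟨u, hu, hs'⟩ := h'.2 Λ M emb exit hM (w.reverse ++ o)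
  refine ⟨1 + t + u, by lia, ?_⟩
  rw [List.reverse_append, List.append_assoc]
  refine Steps.trans (Steps.trans (Steps.one (hM none) ?_) hs) hs'
  obtain ⟨n, hn⟩ := Nat.exists_eq_succ_of_ne_zero hr.ne'
  simp [code, stepAux, stackVals, hn, List.replicate_succ, update_stackVals_register]
  rfl

theorem Runs.read_false : Runs 1 (read p) (false :: i) c i c [] := by
  refine ⟨by simp, fun Λ M emb exit hM o => ⟨1, le_rfl, Steps.one (hM none) ?_⟩⟩
  simp [code, stepAux, stackVals, update_stackVals_input]

theorem Runs.read_true (h : Runs T p i c i' c' w) (h' : Runs U (read p) i' c' i'' c'' w') :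
    Runs (T + U + 1) (read p) (true :: i) c i'' c'' (w ++ w') := by
  refine ⟨by simpa using (Nat.add_le_add h.1 h'.1).trans (Nat.le_succ _),
    fun Λ M emb exit hM o => ?_⟩
  obtain ⟨t, ht, hs⟩ := h.2 Λ M (emb ∘ some) (emb none) (fun l => hM (some l)) o
  obtain ⟨u, hu, hs'⟩ := h'.2 Λ M emb exit hM (w.reverse ++ o)
  refine ⟨1 + t + u, by lia, ?_⟩
  rw [List.reverse_append, List.append_assoc]
  refine Steps.trans (Steps.trans (Steps.one (hM none) ?_) hs) hs'
  simp [code, stepAux, stackVals, update_stackVals_input]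
  rfl

/-- A bound on the running time of a program in which no loop is repeated more often than the
argument of the polynomial says. -/
noncomputable def bound : Prog K → ℕ[X]
  | emit w => C (w.length + 1)
  | inc _ => 1
  | dec _ => 1
  | seq p q => bound p + bound q
  | ifPos _ p => bound p + 1
  | loop _ p => X * (bound p + 1) + 1
  | read p => X * (bound p + 1) + 1

/-! ### Machines that run a program and return its output -/

/-- The machine that runs `p` and then moves the output onto the input stack, which puts the bit
written first on top. The label `none` belongs to this last phase. -/
def machine [Fintype K] (p : Prog K) : FinTM2 where
  K := Bool ⊕ K
  k₀ := .inl false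
  k₁ := .inl false
  Γ _ := Bool
  Λ := Option (Label p)
  main := some (entry p)
  σ := Option Bool
  initialState := none
  m
    | some l => code p some none l
    | none => .pop (.inl true) (fun _ h => h)
        (.branch Option.isSome
          (.push (.inl false) (fun v => v.getD false) (.load (fun _ => none) (.goto fun _ => none)))
          .halt)

/-- The last phase of `machine` pops the output and pushes it onto the input stack, bit by bit. -/
theorem steps_reverse {Λ : Type} {M : Λ → Code K Λ} {l : Λ}
    (hl : M l = .pop (.inl true) (fun _ h => h)
        (.branch Option.isSome
          (.push (.inl false) (fun v => v.getD false) (.load (fun _ => none) (.goto fun _ => l)))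
          .halt)) (o i : List Bool) (c : K → ℕ) :
    Steps M (o.length + 1) ⟨some l, none, stackVals i o c⟩
      ⟨none, none, stackVals (o.reverse ++ i) [] c⟩ := by
  induction o generalizing i with
  | nil =>
    refine Steps.one hl ?_
    simp [stepAux, stackVals, update_stackVals_output]
  | cons b o ih =>
    rw [List.length_cons, Nat.add_comm]
    refine Steps.trans (Steps.one (b := ⟨some l, none, stackVals (b :: i) o c⟩) hl ?_) ?_
    · simp [stepAux, stackVals, update_stackVals_output, update_stackVals_input]
    · simpa using ih (b :: i)

/-- A function is computable in polynomial time if a program that leaves neither input nor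
non-zero registers writes its values within the program's own polynomial bound. -/
noncomputable def computableInPolyTime [Fintype K] {α β : Type} {ea : α → List Bool}
    {eb : β → List Bool} {f : α → β} (p : Prog K)
    (h : ∀ a, Runs (p.bound.eval (ea a).length) p (ea a) 0 [] 0 (eb (f a))) :
    TM2ComputableInPolyTime ea eb f where
  tm := machine p
  inputAlphabet := Equiv.refl Bool
  outputAlphabet := Equiv.refl Bool
  time := p.bound + (p.bound + 1)
  outputsFun a := by
    have h2 : ∃ t ≤ (p.bound + (p.bound + 1)).eval (ea a).length,
        Steps (machine p).m t ⟨some (some (entry p)), none, stackVals (ea a) [] 0⟩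
          ⟨none, none, stackVals (eb (f a)) [] 0⟩ := by
      obtain ⟨t, ht, hs⟩ := (h a).2 (Option (Label p)) (machine p).m some none (fun _ => rfl) []
      have hr := steps_reverse (M := (machine p).m) (l := none) rfl (eb (f a)).reverse [] 0
      simp only [List.length_reverse, List.reverse_reverse, List.append_nil] at hr hs
      refine ⟨_, ?_, hs.trans hr⟩
      -- The output is not longer than the time bound of `p`, so moving it doubles this at most.
      have := (h a).1
      simp only [eval_add, eval_one]
      lia
    have hstk (s : List Bool) : (fun k => @dite (List Bool) (k = Sum.inl false)
        (instDecidableEqSum k (Sum.inl false)) (fun _ => s) (fun _ => [])) =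
          stackVals s [] (0 : K → ℕ) := by
      funext k
      rcases k with (_ | _) | k <;> simp [stackVals]
    have hi : initList (machine p) (List.map (Equiv.refl Bool).invFun (ea a)) =
        ⟨some (some (entry p)), none, stackVals (ea a) [] 0⟩ := by
      rw [← hstk]
      exact congrArg (initList (machine p)) (List.map_id (ea a))
    have ho : haltList (machine p) (List.map (Equiv.refl Bool).invFun (eb (f a))) =
        ⟨none, none, stackVals (eb (f a)) [] 0⟩ := by
      rw [← hstk]
      exact congrArg (haltList (machine p)) (List.map_id (eb (f a)))
    exact
      { steps := h2.choose
        evals_in_steps := by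
          exact (congrArg (fun x => (flip bind (machine p).step)^[h2.choose] (some x)) hi).trans
            (Eq.trans h2.choose_spec.2 (congrArg some ho.symm))
        steps_le_m := h2.choose_spec.1 }

end Prog

/-! ### Rules for deriving the behaviour of programs -/

namespace Prog

open Polynomial

variable {K : Type} [DecidableEq K] {N : ℕ} {p q : Prog K} {i i' i'' : List Bool}
  {c c' c'' : K → ℕ} {r s : K} {w w' : List Bool}

/-- `p` takes the input `i` and the register values `c` to `i'` and `c'` and writes `w`, within
the time that `bound` allows for at most `N` repetitions of each loop. -/
def Exec (N : ℕ) (p : Prog K) (i : List Bool) (c : K → ℕ) (i' : List Bool) (c' : K → ℕ)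
    (w : List Bool) : Prop :=
  Runs (p.bound.eval N) p i c i' c' w

theorem Exec.emit (w : List Bool) (i : List Bool) (c : K → ℕ) :
    Exec N (emit w) i c i c w := by
  simpa [Exec, bound] using Runs.emit w i c

theorem Exec.inc (r : K) (i : List Bool) (c : K → ℕ) :
    Exec N (inc r) i c i (Function.update c r (c r + 1)) [] := by
  simpa [Exec, bound] using Runs.inc r i c

theorem Exec.dec (r : K) (i : List Bool) (c : K → ℕ) :
    Exec N (dec r) i c i (Function.update c r (c r - 1)) [] := by
  simpa [Exec, bound] using Runs.dec r i c

theorem Exec.seq (h : Exec N p i c i' c' w) (h' : Exec N q i' c' i'' c'' w') :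
    Exec N (p.seq q) i c i'' c'' (w ++ w') := by
  simpa [Exec, bound] using Runs.seq h h'

theorem Exec.ifPos (h : 0 < c r → Exec N p i c i c w) :
    Exec N (ifPos r p) i c i c (if c r = 0 then [] else w) := by
  unfold Exec
  split_ifs with hr
  · exact (Runs.ifPos_zero hr).mono (by simp [bound])
  · simpa [bound] using Runs.ifPos_pos (Nat.pos_of_ne_zero hr) (h (Nat.pos_of_ne_zero hr))

theorem Runs.loop_iterate {T : ℕ} : ∀ {n : ℕ} {c : ℕ → K → ℕ} {w : ℕ → List Bool}, c n r = 0 →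
    (∀ m < n, 0 < c m r ∧
      Runs T p i (Function.update (c m) r (c m r - 1)) i (c (m + 1)) (w m)) →
    Runs (n * (T + 1) + 1) (loop r p) i (c 0) i (c n) ((List.range n).flatMap w)
  | 0, _, _, hn, _ => (Runs.loop_zero hn).mono (by simp)
  | n + 1, c, w, hn, h => by
    have h0 := h 0 (by simp)
    have ih := loop_iterate (n := n) (c := fun m => c (m + 1)) (w := fun m => w (m + 1)) hn
      (fun m hm => h (m + 1) (by lia))
    have := (Runs.loop_step h0.1 h0.2 ih).mono (U := (n + 1) * (T + 1) + 1) (by lia)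
    simpa [List.range_succ_eq_map, List.flatMap_map] using this

theorem Exec.loop_iterate {n : ℕ} {c : ℕ → K → ℕ} {w : ℕ → List Bool} (hN : n ≤ N)
    (hn : c n r = 0) (h : ∀ m < n, 0 < c m r ∧
      Exec N p i (Function.update (c m) r (c m r - 1)) i (c (m + 1)) (w m)) :
    Exec N (loop r p) i (c 0) i (c n) ((List.range n).flatMap w) :=
  (Runs.loop_iterate hn h).mono (by simp [bound]; gcongr)

theorem Runs.read_list {T : ℕ} {α : Type} {enc : α → List Bool} {w : α → ℕ → List Bool}
    {c : ℕ → K → ℕ} {rest : List Bool} : ∀ (l : List α) (j : ℕ),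
    (∀ a ∈ l, ∀ m s, j ≤ m → m < j + l.length →
      Runs T p (enc a ++ s) (c m) s (c (m + 1)) (w a m)) →
    Runs (l.length * (T + 1) + 1) (read p) (encList enc l ++ rest) (c j) rest (c (j + l.length))
      ((l.zipIdx j).flatMap fun x => w x.1 x.2)
  | [], _, _ => Runs.read_false.mono (by simp)
  | a :: l, j, h => by
    have ih := read_list (rest := rest) l (j + 1) fun b hb m s hm hm' =>
      h b (by simp [hb]) m s (by lia) (by simp; lia)
    have h0 := h a (by simp) j (encList enc l ++ rest) le_rfl (by simp)
    have := (Runs.read_true h0 ih).mono (U := (l.length + 1) * (T + 1) + 1) (by lia)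
    simpa [encList, Nat.add_assoc, Nat.add_comm 1, List.append_assoc] using this

/-- `read p` parses the code of a list if `p` parses the codes of its elements. Here `c m` are the
register values before the element with index `m`. -/
theorem Exec.read_list {α : Type} {enc : α → List Bool} {w : α → ℕ → List Bool}
    {c : ℕ → K → ℕ} {rest : List Bool} (l : List α) (hN : l.length ≤ N)
    (h : ∀ a ∈ l, ∀ m s, m < l.length → Exec N p (enc a ++ s) (c m) s (c (m + 1)) (w a m)) :
    Exec N (read p) (encList enc l ++ rest) (c 0) rest (c l.length)
      (l.zipIdx.flatMap fun x => w x.1 x.2) := by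
  have := Runs.read_list (rest := rest) l 0 fun a ha m s _ hm => h a ha m s (by simpa using hm)
  rw [Nat.zero_add] at this
  exact this.mono (by simp [bound]; gcongr)

/-- Unary codes are codes of lists without content, so `read` parses them, too. -/
theorem encNat_eq_encList (n : ℕ) :
    encNat n = encList (fun _ : Unit => []) (List.replicate n ()) := by
  induction n with
  | zero => rfl
  | succ n ih => simpa [encNat, encList, List.replicate_succ] using ih

theorem Exec.read_encNat {v : List Bool} {c : ℕ → K → ℕ} {rest : List Bool} (n : ℕ) (hN : n ≤ N)
    (h : ∀ m s, m < n → Exec N p s (c m) s (c (m + 1)) v) :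
    Exec N (read p) (encNat n ++ rest) (c 0) rest (c n) (List.replicate n v).flatten := by
  have := Exec.read_list (N := N) (p := p) (enc := fun _ : Unit => []) (w := fun _ _ => v) (c := c)
    (rest := rest) (List.replicate n ()) (by simpa using hN)
    (fun a _ m s hm => h m s (by simpa using hm))
  rw [encNat_eq_encList]
  simpa [List.flatMap, List.map_const'] using this

/-- Sets the register `r` to `0`. -/
def clear (r : K) : Prog K := loop r (emit [])

theorem Exec.clear (hr : c r ≤ N) : Exec N (clear r) i c i (Function.update c r 0) [] := by
  have := Exec.loop_iterate (N := N) (p := .emit []) (i := i) (r := r) (n := c r)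
    (c := fun m => Function.update c r (c r - m)) (w := fun _ => []) hr (by simp) fun m hm => by
      refine ⟨by simpa using hm, ?_⟩
      have := Exec.emit (N := N) [] i (Function.update c r (c r - (m + 1)))
      simpa [Nat.sub_sub] using this
  have he : (List.range (c r)).flatMap (fun _ => ([] : List Bool)) = [] := by simp
  simpa [Prog.clear, he] using this

/-! ### Programs that only print -/

/-- The program `p` prints `w` and, in the end, has changed neither the input nor the register
values `c`. -/
def Prints (N : ℕ) (p : Prog K) (c : K → ℕ) (w : List Bool) : Prop := ∀ i, Exec N p i c i c w

theorem Prints.emit (w : List Bool) : Prints N (emit w) c w := fun i => Exec.emit w i c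

theorem Prints.seq (h : Prints N p c w) (h' : Prints N q c w') :
    Prints N (p.seq q) c (w ++ w') := fun i => (h i).seq (h' i)

theorem Prints.ifPos (h : 0 < c r → Prints N p c w) :
    Prints N (ifPos r p) c (if c r = 0 then [] else w) := fun i => Exec.ifPos fun hr => h hr i

theorem Prints.of_eq (h : Prints N p c w) (hw : w = w') : Prints N p c w' := hw ▸ h

/-- Runs `p` as often as the register `r` says, with the number of earlier runs in the register
`s`. During this the sum of `r` and `s` stays the same, up to the run that is in progress;
afterwards `r` is restored. -/
def forLoop (r s : K) (p : Prog K) : Prog K := (loop r (p.seq (inc s))).seq (loop s (inc r))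

theorem Prints.forLoop {w : ℕ → List Bool} {n : ℕ} (hrs : r ≠ s) (hr : c r = n) (hn : n ≤ N)
    (hs : c s = 0)
    (h : ∀ m < n, Prints N p (Function.update (Function.update c r (n - m - 1)) s m) (w m)) :
    Prints N (forLoop r s p) c ((List.range n).flatMap w) := by
  intro i
  have h1 := Exec.loop_iterate (N := N) (p := p.seq (.inc s)) (i := i) (r := r) (n := n)
    (c := fun m => Function.update (Function.update c r (n - m)) s m) (w := w) hn
    (by simp [hrs]) fun m hm => by
      refine ⟨by simpa [hrs] using hm, ?_⟩
      convert (h m hm i).seq (Exec.inc s i _) using 1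
      · funext x
        by_cases hx : x = s <;> by_cases hx' : x = r <;> simp_all
      · funext x
        by_cases hx : x = s <;> by_cases hx' : x = r <;> simp_all [Nat.sub_sub]
      · simp
  have h2 := Exec.loop_iterate (N := N) (p := .inc r) (i := i) (r := s) (n := n)
    (c := fun m => Function.update (Function.update c r m) s (n - m)) (w := fun _ => []) hn
    (by simp) fun m hm => by
      refine ⟨by simpa using hm, ?_⟩
      convert Exec.inc r i _ using 1
      funext x
      by_cases hx : x = s <;> by_cases hx' : x = r <;> simp_all [Nat.sub_sub]
  have hc : Function.update (Function.update c r n) s 0 = c := by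
    funext x
    by_cases hx : x = s <;> by_cases hx' : x = r <;> simp_all
  have he : (List.range n).flatMap (fun _ => ([] : List Bool)) = [] := by simp
  simp only [Nat.sub_zero, Nat.sub_self, hc, he] at h1 h2
  simpa [Prog.forLoop] using h1.seq h2

end Prog

/-! ### A program that computes the reduction -/

theorem encList_eq_flatMap {α : Type} (f : α → List Bool) (l : List α) :
    encList f l = l.flatMap (fun a => true :: f a) ++ [false] := by
  induction l with
  | nil => rfl
  | cons a l ih => simp [encList, ih]

/-- The registers of the program: `V`, `D`, `E`, `E1`, `E2`, `k`, `k1` hold `|V|`, `|V| - k`, `|E|`,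
`|E| - 1`, `|E|`, `k`, `k - 1` after the input has been read; `i` and `j` are loop indices; `t`
and `u` are indices of the innermost loops, which print a number. -/
inductive Reg
  | V | D | E | E1 | E2 | k | k1 | i | j | t | u
  deriving DecidableEq

instance : Fintype Reg :=
  ⟨{.V, .D, .E, .E1, .E2, .k, .k1, .i, .j, .t, .u}, fun r => by cases r <;> simp⟩

namespace Prog

variable {N : ℕ} {c : Reg → ℕ}

/-- Prints the unary code of `a` times the value of `r`, plus `d`. -/
def num (r : Reg) (a d : ℕ) : Prog Reg :=
  (forLoop r .t (emit (List.replicate a true))).seq (emit (encNat d))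

theorem flatMap_range_replicate {α : Type} (n a : ℕ) (x : α) :
    (List.range n).flatMap (fun _ => List.replicate a x) = List.replicate (a * n) x := by
  induction n with
  | zero => simp
  | succ n ih => simp [List.range_succ, ih, Nat.mul_succ]

theorem replicate_append_encNat (a b : ℕ) :
    List.replicate a true ++ encNat b = encNat (a + b) := by
  rw [encNat, encNat, List.replicate_add, List.append_assoc]

theorem Prints.num {r : Reg} {n : ℕ} (a d : ℕ) (hr : c r = n) (hn : n ≤ N) (ht : c .t = 0)
    (hrt : r ≠ .t) : Prints N (num r a d) c (encNat (a * n + d)) :=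
  ((Prints.forLoop hrt hr hn ht fun _ _ => Prints.emit _).seq (Prints.emit _)).of_eq (by
    rw [flatMap_range_replicate, replicate_append_encNat])

/-- Prints an entry of a list of pairs. -/
def pairEntry (p q : Prog Reg) : Prog Reg := (emit [true]).seq (p.seq q)

theorem Prints.pairEntry {p q : Prog Reg} {a b : ℕ} (hp : Prints N p c (encNat a))
    (hq : Prints N q c (encNat b)) :
    Prints N (pairEntry p q) c (true :: encPair encNat encNat (a, b)) :=
  (Prints.emit _).seq (hp.seq hq)

/-- Prints an entry of a list of continuous valencies. -/
def valencyEntry (p q : Prog Reg) : Prog Reg := (emit [true, false]).seq (p.seq q)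

theorem Prints.valencyEntry {p q : Prog Reg} {a b : ℕ} (hp : Prints N p c (encNat a))
    (hq : Prints N q c (encNat b)) :
    Prints N (valencyEntry p q) c (true :: Valency.encode ⟨false, a, b⟩) :=
  (Prints.emit _).seq (hp.seq hq)

/-- Prints an entry of a list of word classes with a single unrestricted domain. -/
def classEntry (p q : Prog Reg) : Prog Reg :=
  (emit [true]).seq (p.seq (q.seq (emit [false, true, false, false, false])))

theorem Prints.classEntry {p q : Prog Reg} {a : ℕ} {v : List Valency}
    (hp : Prints N p c (encNat a))
    (hq : Prints N q c (v.flatMap fun x => true :: Valency.encode x)) :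
    Prints N (classEntry p q) c (true :: (VCInstance.freeClass a v).encode) :=
  ((Prints.emit _).seq (hp.seq (hq.seq (Prints.emit _)))).of_eq (by
    simp [WordClass.encode, VCInstance.freeClass, encList_eq_flatMap, DomainSpec.encode])

end Prog

namespace VCInstance

open Prog

variable (I : VCInstance)

/-- The register values before the element with index `m` is read from the code of `|V|`. -/
def regsV (m : ℕ) : Reg → ℕ
  | .V => m
  | .D => m
  | _ => 0

/-- The register values before the edge with index `m` is read. -/
def regsE (m : ℕ) : Reg → ℕ
  | .V => I.numV
  | .D => I.numV
  | .E => m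
  | .E1 => m
  | .E2 => m
  | _ => 0

/-- The register values before the element with index `m` is read from the code of `k`. -/
def regsK (m : ℕ) : Reg → ℕ
  | .V => I.numV
  | .D => I.numV - m
  | .E => I.numE
  | .E1 => I.numE - 1
  | .E2 => I.numE
  | .k => m
  | .k1 => m
  | _ => 0

/-- The register values after the input has been read. -/
def regs : Reg → ℕ
  | .V => I.numV
  | .D => I.numV - I.k
  | .E => I.numE
  | .E1 => I.numE - 1
  | .E2 => I.numE
  | .k => I.k
  | .k1 => I.k - 1
  | _ => 0

/-- `N` bounds the numbers that determine all register values. -/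
structure IsBound (N : ℕ) : Prop where
  numV : I.numV ≤ N
  numE : I.numE ≤ N
  k : I.k ≤ N

theorem le_length_encList {α : Type} (f : α → List Bool) (l : List α) :
    l.length ≤ (encList f l).length := by
  induction l with
  | nil => simp
  | cons a l ih => simp [encList]; lia

theorem isBound_length_encode : I.IsBound I.encode.length := by
  have := le_length_encList (encPair encNat encNat) I.edges
  constructor <;> simp [encode, encNat, numE] <;> lia

variable {N : ℕ}

/-- Prints the entries of the lexicon for the classes `U_i` and `V_i`. -/
def printLexV : Prog Reg :=
  forLoop .V .i ((pairEntry (num .i 1 1) (num .i 3 4)).seq (pairEntry (num .i 1 1) (num .i 3 5)))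

theorem prints_printLexV (hN : I.IsBound N) : Prints N printLexV (I.regsE 0)
    ((List.range I.numV).flatMap fun i => [(wordV i, clsUi i), (wordV i, clsVi i)].flatMap
      fun p => true :: encPair encNat encNat p) := by
  refine Prints.forLoop (by simp) rfl hN.numV rfl fun m hm => ?_
  have hm' := hm.le.trans hN.numV
  refine ((Prints.pairEntry (.num 1 1 (n := m) ?_ hm' ?_ ?_) (.num 3 4 (n := m) ?_ hm' ?_ ?_)).seq
    (Prints.pairEntry (.num 1 1 (n := m) ?_ hm' ?_ ?_)
      (.num 3 5 (n := m) ?_ hm' ?_ ?_))).of_eq ?_ <;>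
  simp [regsE, wordV, clsUi, clsVi]

/-- Prints the lexicon entry of an end point of the edge `e_j`, where `j` is the value of `E`. The
code of the end point is copied from the input, with the addition of one bit `true` since
`wordV i = i + 1`. -/
def copyEndpoint : Prog Reg :=
  (emit [true]).seq ((Prog.read (emit [true])).seq ((emit [true, false]).seq (num .E 3 3)))

theorem exec_copyEndpoint {j a : ℕ} {s : List Bool} (ha : a ≤ N) (hj : j ≤ N) :
    Exec N copyEndpoint (encNat a ++ s) (I.regsE j) s (I.regsE j)
      (true :: encPair encNat encNat (wordV a, clsH j)) := by
  have h1 := Exec.read_encNat (N := N) (p := .emit [true]) (c := fun _ => I.regsE j) (rest := s) a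
    ha (fun _ _ _ => Exec.emit _ _ _)
  have h2 : Prints N (num .E 3 3) (I.regsE j) _ := Prints.num 3 3 (n := j) rfl hj rfl (by simp)
  convert (Exec.emit [true] _ _).seq (h1.seq ((Exec.emit [true, false] _ _).seq (h2 s))) using 1
  · rfl
  · rw [encPair, show encNat (wordV a) = List.replicate a true ++ [true, false] by
      simp [wordV, encNat, List.replicate_succ']]
    simp [clsH]

/-- Reads the edges, counts them, and prints the lexicon entries of their end points. -/
def readEdges : Prog Reg :=
  Prog.read (copyEndpoint.seq (copyEndpoint.seq ((inc .E).seq ((inc .E1).seq (inc .E2)))))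

theorem exec_readEdges (hN : I.IsBound N) (s : List Bool) :
    Exec N readEdges (encList (encPair encNat encNat) I.edges ++ s) (I.regsE 0) s
      (I.regsE I.numE) (I.edges.zipIdx.flatMap fun p =>
        [(wordV p.1.1, clsH p.2), (wordV p.1.2, clsH p.2)].flatMap
          fun p => true :: encPair encNat encNat p) := by
  refine Exec.read_list (c := I.regsE) (w := fun e j =>
    [(wordV e.1, clsH j), (wordV e.2, clsH j)].flatMap fun p => true :: encPair encNat encNat p)
    I.edges hN.numE fun e he j s hj => ?_
  have he' := I.edges_lt e he
  have hj' : j ≤ N := hj.le.trans hN.numE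
  have h := (I.exec_copyEndpoint (s := encNat e.2 ++ s) (he'.1.le.trans hN.numV) hj').seq
    ((I.exec_copyEndpoint (s := s) (he'.2.le.trans hN.numV) hj').seq
      ((Exec.inc .E s _).seq ((Exec.inc .E1 s _).seq (Exec.inc .E2 s _))))
  convert h using 1
  · simp [encPair]
  · funext r
    cases r <;> simp [regsE]
  · simp

/-- Prints the class `S`. The dependency index `x * |E| + y` is printed in the loop over `y < |E|`,
which uses the register `E`; so a second copy `E2` of `|E|` is needed to print the product. -/
def printS : Prog Reg :=
  classEntry (emit (encNat clsS)) (ifPos .k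
    ((forLoop .D .i (valencyEntry (num .i 3 0) (emit (encNat clsU)))).seq
    ((forLoop .E .i (valencyEntry (num .i 3 1) (num .i 3 3))).seq
    (forLoop .k1 .i (forLoop .E .j (valencyEntry
      ((forLoop .i .t (forLoop .E2 .u (emit [true, true, true]))).seq (num .j 3 2))
      (emit (encNat clsR))))))))

theorem range_mul_flatMap {α : Type} (a b : ℕ) (f : ℕ → List α) :
    (List.range (a * b)).flatMap f =
      (List.range a).flatMap fun x => (List.range b).flatMap fun y => f (x * b + y) := by
  induction a with
  | zero => simp
  | succ a ih =>
    simp [Nat.succ_mul, List.range_add, List.range_succ, ih, List.flatMap_map]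

theorem prints_printS (hN : I.IsBound N) :
    Prints N printS I.regs (true :: (freeClass clsS I.valenciesS).encode) := by
  obtain ⟨hV, hE, hk⟩ := hN
  refine Prints.classEntry (Prints.emit _) ?_
  have h1 : Prints N (forLoop .D .i (valencyEntry (num .i 3 0) (emit (encNat clsU)))) I.regs
      ((List.range (I.numV - I.k)).flatMap fun a =>
        true :: Valency.encode ⟨false, depU a, clsU⟩) :=
    Prints.forLoop (by simp) rfl (by lia) rfl fun m hm =>
      Prints.valencyEntry (Prints.num 3 0 (by simp) (by lia) (by simp [regs]) (by simp))
        (Prints.emit _)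
  have h2 : Prints N (forLoop .E .i (valencyEntry (num .i 3 1) (num .i 3 3))) I.regs
      ((List.range I.numE).flatMap fun j => true :: Valency.encode ⟨false, depH j, clsH j⟩) :=
    Prints.forLoop (by simp) rfl hE rfl fun m hm =>
      Prints.valencyEntry (Prints.num 3 1 (by simp) (by lia) (by simp [regs]) (by simp))
        (Prints.num 3 3 (by simp) (by lia) (by simp [regs]) (by simp))
  have h3 : Prints N (forLoop .k1 .i (forLoop .E .j (valencyEntry
      ((forLoop .i .t (forLoop .E2 .u (emit [true, true, true]))).seq (num .j 3 2))
      (emit (encNat clsR))))) I.regs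
      ((List.range (I.k - 1)).flatMap fun x => (List.range I.numE).flatMap fun y =>
        true :: Valency.encode ⟨false, depR (x * I.numE + y), clsR⟩) := by
    refine Prints.forLoop (by simp) rfl (by lia) rfl fun x hx => ?_
    refine Prints.forLoop (n := I.numE) (by simp) (by simp [regs]) hE (by simp [regs])
      fun y hy => ?_
    refine Prints.valencyEntry ?_ (Prints.emit _)
    refine ((Prints.forLoop (n := x) (by simp) (by simp) (by lia) (by simp [regs])
      fun z hz => Prints.forLoop (n := I.numE) (by simp) (by simp [regs]) hE (by simp [regs])
        fun _ _ => Prints.emit _).seq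
        (Prints.num 3 2 (n := y) (by simp) (by lia) (by simp [regs]) (by simp))).of_eq ?_
    rw [show [true, true, true] = List.replicate 3 true from rfl]
    simp only [flatMap_range_replicate, replicate_append_encNat, depR]
    congr 1
    ring
  refine (Prints.ifPos fun _ => h1.seq (h2.seq h3)).of_eq ?_
  rw [show I.regs .k = I.k from rfl, valenciesS]
  split_ifs
  · rfl
  · simp only [List.flatMap_append, List.flatMap_map, range_mul_flatMap, List.append_assoc]

/-- Prints the word classes. -/
def printClasses : Prog Reg :=
  printS.seq ((classEntry (emit (encNat clsR)) (emit [])).seq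
  ((classEntry (emit (encNat clsU)) (emit [])).seq
  ((forLoop .E .i (classEntry (num .i 3 3) (emit []))).seq
  ((forLoop .V .i (classEntry (num .i 3 4)
    (forLoop .E1 .j (valencyEntry (num .j 3 2) (num .i 3 5))))).seq
  ((forLoop .V .i (classEntry (num .i 3 5) (emit []))).seq (emit [false]))))))

theorem prints_printClasses (hN : I.IsBound N) :
    Prints N printClasses I.regs (encList WordClass.encode I.grammar.classes) := by
  have hS := I.prints_printS hN
  obtain ⟨hV, hE, hk⟩ := hN
  have h1 : Prints N (forLoop .E .i (classEntry (num .i 3 3) (emit []))) I.regs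
      ((List.range I.numE).flatMap fun j => true :: (freeClass (clsH j) []).encode) :=
    Prints.forLoop (by simp) rfl hE rfl fun m hm => Prints.classEntry
      (Prints.num 3 3 (by simp) (by lia) (by simp [regs]) (by simp)) (Prints.emit _)
  have h2 : Prints N (forLoop .V .i (classEntry (num .i 3 4)
      (forLoop .E1 .j (valencyEntry (num .j 3 2) (num .i 3 5))))) I.regs
      ((List.range I.numV).flatMap fun i =>
        true :: (freeClass (clsUi i) (I.valenciesUi i)).encode) :=
    Prints.forLoop (by simp) rfl hV rfl fun m hm => Prints.classEntry
      (Prints.num 3 4 (by simp) (by lia) (by simp [regs]) (by simp))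
      ((Prints.forLoop (n := I.numE - 1) (by simp) (by simp [regs]) (by lia) (by simp [regs])
        fun b hb => Prints.valencyEntry
          (Prints.num 3 2 (n := b) (by simp) (by lia) (by simp [regs]) (by simp))
          (Prints.num 3 5 (n := m) (by simp) (by lia) (by simp [regs]) (by simp))).of_eq
        (by rw [valenciesUi, List.flatMap_map]; rfl))
  have h3 : Prints N (forLoop .V .i (classEntry (num .i 3 5) (emit []))) I.regs
      ((List.range I.numV).flatMap fun i => true :: (freeClass (clsVi i) []).encode) :=
    Prints.forLoop (by simp) rfl hV rfl fun m hm => Prints.classEntry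
      (Prints.num 3 5 (by simp) (by lia) (by simp [regs]) (by simp)) (Prints.emit _)
  have h0 (a : ℕ) : Prints N (classEntry (emit (encNat a)) (emit [])) I.regs
      (true :: (freeClass a []).encode) :=
    Prints.classEntry (Prints.emit _) (Prints.emit _)
  refine (hS.seq ((h0 clsR).seq ((h0 clsU).seq
    (h1.seq (h2.seq (h3.seq (Prints.emit [false]))))))).of_eq ?_
  simp [encList_eq_flatMap, grammar, List.flatMap_map]

/-- Prints the subclass pairs. -/
def printIsa : Prog Reg :=
  (forLoop .V .i ((pairEntry (num .i 3 4) (emit (encNat clsU))).seq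
    (pairEntry (num .i 3 5) (emit (encNat clsR))))).seq (emit [false])

theorem prints_printIsa (hN : I.IsBound N) :
    Prints N printIsa I.regs (encList (encPair encNat encNat) I.grammar.isa) := by
  have h : Prints N (forLoop .V .i ((pairEntry (num .i 3 4) (emit (encNat clsU))).seq
      (pairEntry (num .i 3 5) (emit (encNat clsR))))) I.regs
      ((List.range I.numV).flatMap fun i => [(clsUi i, clsU), (clsVi i, clsR)].flatMap
        fun p => true :: encPair encNat encNat p) :=
    Prints.forLoop (by simp) rfl hN.numV rfl fun m hm =>
      have hm' := hm.le.trans hN.numV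
      ((Prints.pairEntry (.num 3 4 (by simp) hm' (by simp [regs]) (by simp)) (Prints.emit _)).seq
        (Prints.pairEntry (.num 3 5 (by simp) hm' (by simp [regs]) (by simp))
          (Prints.emit _))).of_eq (by simp [clsUi, clsVi])
  refine (h.seq (Prints.emit _)).of_eq ?_
  simp [encList_eq_flatMap, grammar, List.flatMap_assoc]

/-- Prints the alphabet. -/
def printAlphabet : Prog Reg :=
  (emit [true, false]).seq ((forLoop .V .i ((emit [true]).seq (num .i 1 1))).seq (emit [false]))

theorem prints_printAlphabet (hN : I.IsBound N) :
    Prints N printAlphabet I.regs (encList encNat I.grammar.alphabet) := by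
  have h : Prints N (forLoop .V .i ((emit [true]).seq (num .i 1 1))) I.regs
      ((List.range I.numV).flatMap fun i => true :: encNat (wordV i)) :=
    Prints.forLoop (by simp) rfl hN.numV rfl fun m hm =>
      ((Prints.emit _).seq (.num 1 1 (n := m) (by simp) (hm.le.trans hN.numV) (by simp [regs])
        (by simp))).of_eq (by simp [wordV])
  refine ((Prints.emit _).seq (h.seq (Prints.emit _))).of_eq ?_
  simp [encList_eq_flatMap, grammar, List.flatMap_map, wordS, encNat]

/-- Prints the string. -/
def printString : Prog Reg :=
  (emit [true, false]).seq
    ((forLoop .V .i (forLoop .E .j ((emit [true]).seq (num .i 1 1)))).seq (emit [false]))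

theorem prints_printString (hN : I.IsBound N) :
    Prints N printString I.regs (encList encNat I.string) := by
  have h : Prints N (forLoop .V .i (forLoop .E .j ((emit [true]).seq (num .i 1 1)))) I.regs
      ((List.range I.numV).flatMap fun i => (List.range I.numE).flatMap fun _ =>
        true :: encNat (wordV i)) :=
    Prints.forLoop (by simp) rfl hN.numV rfl fun m hm =>
      Prints.forLoop (by simp) (by simp [regs]) hN.numE (by simp [regs]) fun _ _ =>
      ((Prints.emit _).seq (.num 1 1 (n := m) (by simp) (hm.le.trans hN.numV) (by simp [regs])
        (by simp))).of_eq (by simp [wordV])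
  refine ((Prints.emit _).seq (h.seq (Prints.emit _))).of_eq ?_
  have hr (n : ℕ) (l : List Bool) : (List.range n).flatMap (fun _ => l) =
      (List.replicate n l).flatten := by
    simp [List.flatMap, List.map_const']
  have hr' (n w : ℕ) : (List.replicate n w).flatMap (fun a => true :: encNat a) =
      (List.replicate n (true :: encNat w)).flatten := by
    simp [List.flatMap]
  simp only [encList_eq_flatMap, string, List.flatMap_cons, List.flatMap_assoc, hr, hr',
    List.append_assoc]
  rfl

/-- Computes the code of `⟨G(V, E, k), σ(V, E, k)⟩` from that of `⟨V, E, k⟩`. -/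
def program : Prog Reg :=
  (Prog.read ((inc .V).seq (inc .D))).seq
  ((pairEntry (emit (encNat wordS)) (emit (encNat clsS))).seq (printLexV.seq
  (readEdges.seq ((emit [false]).seq ((dec .E1).seq
  ((Prog.read ((dec .D).seq ((inc .k).seq (inc .k1)))).seq ((dec .k1).seq
  (printClasses.seq (printIsa.seq (printAlphabet.seq (printString.seq
  ((clear .V).seq ((clear .D).seq ((clear .E).seq ((clear .E1).seq ((clear .E2).seq
  ((clear .k).seq (clear .k1))))))))))))))))))

theorem exec_program : Exec I.encode.length program I.encode 0 [] 0 I.toDG.encode := by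
  have hN := I.isBound_length_encode
  generalize I.encode.length = N at hN
  have h1 := Exec.read_encNat (N := N) (p := (inc Reg.V).seq (inc .D)) (c := regsV) (v := [])
    (rest := encList (encPair encNat encNat) I.edges ++ encNat I.k) I.numV hN.numV
    fun m s hm => by
      convert (Exec.inc Reg.V s _).seq (Exec.inc Reg.D s _) using 1
      · funext r
        cases r <;> simp [regsV]
      · simp
  have h2 := Exec.read_encNat (N := N) (p := (dec Reg.D).seq ((inc .k).seq (inc .k1)))
    (c := I.regsK) (v := []) (rest := []) I.k hN.k
    fun m s hm => by
      convert (Exec.dec Reg.D s _).seq ((Exec.inc Reg.k s _).seq (Exec.inc Reg.k1 s _)) using 1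
      · funext r
        cases r <;> simp [regsK, Nat.sub_sub]
      · simp
  have e1 : regsV 0 = 0 := by funext r; cases r <;> rfl
  have e2 : regsV I.numV = I.regsE 0 := by funext r; cases r <;> rfl
  have e3 : Function.update (I.regsE I.numE) .E1 (I.regsE I.numE .E1 - 1) = I.regsK 0 := by
    funext r; cases r <;> simp [regsE, regsK]
  have e4 : Function.update (I.regsK I.k) .k1 (I.regsK I.k .k1 - 1) = I.regs := by
    funext r; cases r <;> simp [regs, regsK]
  rw [e1, e2] at h1
  rw [List.append_nil] at h2
  have h3 := Exec.dec (N := N) .E1 (encNat I.k) (I.regsE I.numE)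
  rw [e3] at h3
  have h4 := Exec.dec (N := N) .k1 [] (I.regsK I.k)
  rw [e4] at h4
  have hc (r : Reg) (c : Reg → ℕ) (hr : c r ≤ I.regs r) :
      Exec N (clear r) [] c [] (Function.update c r 0) [] := Exec.clear <| hr.trans <| by
    obtain ⟨hV, hE, hk⟩ := hN
    cases r <;> simp only [regs] <;> lia
  have h5 := (hc .V I.regs le_rfl).seq ((hc .D _ (by simp)).seq ((hc .E _ (by simp)).seq
    ((hc .E1 _ (by simp)).seq ((hc .E2 _ (by simp)).seq ((hc .k _ (by simp)).seq
      (hc .k1 _ (by simp)))))))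
  have := h1.seq ((Prints.pairEntry (Prints.emit (encNat wordS)) (Prints.emit (encNat clsS)) _).seq
    ((I.prints_printLexV hN _).seq ((I.exec_readEdges hN _).seq ((Exec.emit [false] _ _).seq
    (h3.seq (h2.seq (h4.seq ((I.prints_printClasses hN _).seq ((I.prints_printIsa hN _).seq
    ((I.prints_printAlphabet hN _).seq ((I.prints_printString hN _).seq h5)))))))))))
  convert this using 1
  · rfl
  · rfl
  · funext r
    cases r <;> simp [regs]
  · have hlex : encList (encPair encNat encNat) I.grammar.lex =
        (true :: encPair encNat encNat (wordS, clsS)) ++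
        (((List.range I.numV).flatMap fun i => [(wordV i, clsUi i), (wordV i, clsVi i)].flatMap
          fun p => true :: encPair encNat encNat p) ++
        ((I.edges.zipIdx.flatMap fun p =>
          [(wordV p.1.1, clsH p.2), (wordV p.1.2, clsH p.2)].flatMap
            fun p => true :: encPair encNat encNat p) ++ [false])) := by
      simp only [encList_eq_flatMap, grammar, List.flatMap_cons, List.flatMap_append,
        List.flatMap_assoc, List.append_assoc]
    simp only [DGInstance.encode, toDG, DepGrammar.encode, hlex]
    simp

end VCInstance

/-! ### The components of the constructed grammar -/

namespace VCInstance

variable (I : VCInstance)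

theorem mem_lex {w c : ℕ} : (w, c) ∈ I.grammar.lex ↔ (w = wordS ∧ c = clsS) ∨
    (∃ i < I.numV, w = wordV i ∧ (c = clsUi i ∨ c = clsVi i)) ∨
    ∃ j, ∃ h : j < I.numE, c = clsH j ∧
      (w = wordV (I.edges[j]'h).1 ∨ w = wordV (I.edges[j]'h).2) := by
  simp only [grammar, List.mem_cons, List.mem_append, List.mem_flatMap, List.mem_range,
    Prod.mk.injEq, List.not_mem_nil, or_false, numE]
  refine or_congr Iff.rfl (or_congr ?_ ?_)
  · exact exists_congr fun i => and_congr_right fun _ => by tauto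
  · constructor
    · rintro ⟨⟨e, j⟩, he, h⟩
      obtain ⟨hj, he⟩ := List.getElem?_eq_some_iff.1 (List.mem_zipIdx_iff_getElem?.1 he)
      dsimp only at hj he h
      subst he
      exact ⟨j, hj, by tauto⟩
    · rintro ⟨j, hj, rfl, h⟩
      exact ⟨(I.edges[j], j), List.mem_zipIdx_iff_getElem?.2 (List.getElem?_eq_getElem hj),
        by tauto⟩

theorem mem_classes {c : WordClass} : c ∈ I.grammar.classes ↔
    c = freeClass clsS I.valenciesS ∨ c = freeClass clsR [] ∨ c = freeClass clsU [] ∨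
    (∃ j < I.numE, c = freeClass (clsH j) []) ∨
    (∃ i < I.numV, c = freeClass (clsUi i) (I.valenciesUi i)) ∨
    (∃ i < I.numV, c = freeClass (clsVi i) []) := by
  simp [grammar, eq_comm]

theorem mem_valenciesS {v : Valency} : v ∈ I.valenciesS ↔ I.k ≠ 0 ∧
    ((∃ a < I.numV - I.k, v = ⟨false, depU a, clsU⟩) ∨
    (∃ j < I.numE, v = ⟨false, depH j, clsH j⟩) ∨
    (∃ b < (I.k - 1) * I.numE, v = ⟨false, depR b, clsR⟩)) := by
  unfold valenciesS
  split_ifs with hk <;> simp [hk, eq_comm]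

theorem mem_valenciesUi {i : ℕ} {v : Valency} : v ∈ I.valenciesUi i ↔
    ∃ b < I.numE - 1, v = ⟨false, depR b, clsVi i⟩ := by
  simp [valenciesUi, eq_comm]

theorem mem_isa {a b : ℕ} : (a, b) ∈ I.grammar.isa ↔
    ∃ i < I.numV, (a = clsUi i ∧ b = clsU) ∨ (a = clsVi i ∧ b = clsR) := by
  simp [grammar]

theorem isa_iff {a b : ℕ} : I.grammar.Isa a b ↔
    a = b ∨ ∃ i < I.numV, (a = clsUi i ∧ b = clsU) ∨ (a = clsVi i ∧ b = clsR) := by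
  constructor
  · intro h
    induction h using Relation.ReflTransGen.head_induction_on with
    | refl => exact .inl rfl
    | head h _ ih =>
      obtain ⟨i, hi, h⟩ := I.mem_isa.1 h
      rcases ih with rfl | ⟨i', _, h'⟩
      · exact .inr ⟨i, hi, h⟩
      · simp only [clsUi, clsVi, clsU, clsR] at h h'
        lia
  · rintro (rfl | h)
    · exact .refl
    · exact .single (I.mem_isa.2 h)

theorem mem_classNames {a : ℕ} : a ∈ I.grammar.classNames ↔
    a = clsS ∨ a = clsR ∨ a = clsU ∨ (∃ j < I.numE, a = clsH j) ∨
    (∃ i < I.numV, a = clsUi i) ∨ (∃ i < I.numV, a = clsVi i) := by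
  simp [grammar, DepGrammar.classNames, freeClass, eq_comm]

variable {I} in
theorem clsH_mem {j : ℕ} (hj : j < I.numE) : clsH j ∈ I.grammar.classNames :=
  I.mem_classNames.2 (.inr (.inr (.inr (.inl ⟨j, hj, rfl⟩))))

variable {I} in
theorem clsUi_mem {i : ℕ} (hi : i < I.numV) : clsUi i ∈ I.grammar.classNames :=
  I.mem_classNames.2 (.inr (.inr (.inr (.inr (.inl ⟨i, hi, rfl⟩)))))

variable {I} in
theorem clsVi_mem {i : ℕ} (hi : i < I.numV) : clsVi i ∈ I.grammar.classNames :=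
  I.mem_classNames.2 (.inr (.inr (.inr (.inr (.inr ⟨i, hi, rfl⟩)))))

variable {I} in
theorem wordV_mem {i : ℕ} (hi : i < I.numV) : wordV i ∈ I.grammar.alphabet :=
  List.mem_cons_of_mem _ (List.mem_map_of_mem (List.mem_range.2 hi))

theorem nodup_classNames : I.grammar.classNames.Nodup := by
  have h : I.grammar.classNames = [clsS, clsR, clsU] ++ (List.range I.numE).map clsH ++
      (List.range I.numV).map clsUi ++ (List.range I.numV).map clsVi := by
    simp [grammar, DepGrammar.classNames, freeClass, Function.comp_def]
  rw [h]
  simp only [List.nodup_append', List.nodup_map_iff_inj_on (List.nodup_range), List.Disjoint,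
    List.mem_append, List.mem_map, clsS, clsR, clsU, clsH, clsUi, clsVi]
  refine ⟨⟨⟨by simp, ?_, ?_⟩, ?_, ?_⟩, ?_, ?_⟩ <;> simp <;> lia

theorem wellFormed_grammar : I.grammar.WellFormed where
  nodup := I.nodup_classNames
  lex_mem := by
    rintro ⟨w, c⟩ h
    dsimp only
    rcases I.mem_lex.1 h with ⟨hw, hc⟩ | ⟨i, hi, rfl, h'⟩ | ⟨j, hj, rfl, h'⟩
    · rw [hw, hc, mem_classNames]
      simp [grammar]
    · exact ⟨wordV_mem hi, by rcases h' with rfl | rfl; exacts [clsUi_mem hi, clsVi_mem hi]⟩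
    · have he := I.edges_lt I.edges[j] (List.getElem_mem _)
      refine ⟨?_, clsH_mem hj⟩
      rcases h' with rfl | rfl
      exacts [wordV_mem he.1, wordV_mem he.2]
  isa_mem := by
    rintro ⟨a, b⟩ h
    obtain ⟨i, hi, ⟨rfl, rfl⟩ | ⟨rfl, rfl⟩⟩ := I.mem_isa.1 h
    exacts [⟨clsUi_mem hi, by simp [mem_classNames]⟩, ⟨clsVi_mem hi, by simp [mem_classNames]⟩]
  isa_antisymm a b h h' := by
    rcases I.isa_iff.1 h with rfl | ⟨i, _, h⟩
    · rfl
    rcases I.isa_iff.1 h' with rfl | ⟨i', _, h'⟩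
    · rfl
    simp only [clsUi, clsVi, clsU, clsR] at h h'
    lia
  valency_mem c hc v hv := by
    rcases I.mem_classes.1 hc with
      rfl | rfl | rfl | ⟨j, hj, rfl⟩ | ⟨i, hi, rfl⟩ | ⟨i, hi, rfl⟩
    · obtain ⟨-, ⟨a, _, rfl⟩ | ⟨j, hj, rfl⟩ | ⟨b, _, rfl⟩⟩ := I.mem_valenciesS.1 hv
      · simp [mem_classNames]
      · exact clsH_mem hj
      · simp [mem_classNames]
    · cases hv
    · cases hv
    · cases hv
    · obtain ⟨b, _, rfl⟩ := I.mem_valenciesUi.1 hv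
      exact clsVi_mem hi
    · cases hv
  domains_ne c hc := by
    rcases I.mem_classes.1 hc with
      rfl | rfl | rfl | ⟨j, hj, rfl⟩ | ⟨i, hi, rfl⟩ | ⟨i, hi, rfl⟩ <;> simp [freeClass]

theorem onlyContinuous_grammar : I.grammar.OnlyContinuous := by
  intro c hc v hv
  rcases I.mem_classes.1 hc with
    rfl | rfl | rfl | ⟨j, hj, rfl⟩ | ⟨i, hi, rfl⟩ | ⟨i, hi, rfl⟩
  · obtain ⟨-, ⟨a, _, rfl⟩ | ⟨j, hj, rfl⟩ | ⟨b, _, rfl⟩⟩ := I.mem_valenciesS.1 hv <;> rfl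
  · cases hv
  · cases hv
  · cases hv
  · obtain ⟨b, _, rfl⟩ := I.mem_valenciesUi.1 hv
    rfl
  · cases hv

theorem isPossible_toDG : I.toDG.IsPossible := by
  refine ⟨I.wellFormed_grammar, by simp [toDG, string], fun w hw => ?_⟩
  simp only [toDG, string, List.mem_cons, List.mem_flatMap, List.mem_range] at hw
  rcases hw with rfl | ⟨i, hi, hw⟩
  · simp [toDG, grammar]
  · rw [List.eq_of_mem_replicate hw]
    exact wordV_mem hi

/-! ### Positions in the constructed string -/

theorem length_string : I.string.length = 1 + I.numV * I.numE := by
  simp [string, Nat.add_comm]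

theorem getElem?_flatMap_replicate {α : Type} (f : ℕ → α) (m : ℕ) :
    ∀ {n q : ℕ}, q < n * m →
      ((List.range n).flatMap fun i => List.replicate m (f i))[q]? = some (f (q / m))
  | 0, q, hq => by simp at hq
  | n + 1, q, hq => by
    rw [List.range_succ, List.flatMap_append, List.getElem?_append]
    have hl : ((List.range n).flatMap fun i => List.replicate m (f i)).length = n * m := by simp
    rw [hl]
    split_ifs with h
    · exact getElem?_flatMap_replicate f m h
    · have hm : 0 < m := by
        rcases Nat.eq_zero_or_pos m with rfl | hm
        · simp at hq
        · exact hm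
      have h1 : q - n * m < m := by rw [Nat.succ_mul] at hq; lia
      have h2 : q / m = n := (Nat.div_eq_iff hm).2 ⟨by lia, by lia⟩
      simp [h1, h2]

/-- The vertex at position `p ≠ 0` of the string. -/
def vert (p : ℕ) : ℕ := (p - 1) / I.numE

/-- The number of earlier occurrences of the vertex at position `p ≠ 0` of the string. -/
def copy (p : ℕ) : ℕ := (p - 1) % I.numE

theorem get_string_zero (h : 0 < I.string.length) : I.string.get ⟨0, h⟩ = wordS := rfl

theorem get_string {p : Fin I.string.length} (hp : p.val ≠ 0) :
    I.string.get p = wordV (I.vert p) := by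
  obtain ⟨p, hlt⟩ := p
  obtain ⟨q, rfl⟩ := Nat.exists_eq_succ_of_ne_zero hp
  have hq : q < I.numV * I.numE := by rw [length_string] at hlt; lia
  have h := getElem?_flatMap_replicate wordV I.numE hq
  have h' : I.string[q + 1]? = some (wordV (q / I.numE)) := by
    rw [string, List.getElem?_cons_succ]; exact h
  exact (List.getElem?_eq_some_iff.1 h').2

variable {I}

theorem position_spec {p : ℕ} (hp : p ≠ 0) (hlt : p < I.string.length) :
    I.vert p < I.numV ∧ I.copy p < I.numE ∧ p = 1 + I.vert p * I.numE + I.copy p := by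
  rw [length_string] at hlt
  have hE : 0 < I.numE := by
    rcases Nat.eq_zero_or_pos I.numE with h | h
    · rw [h] at hlt; lia
    · exact h
  refine ⟨(Nat.div_lt_iff_lt_mul hE).2 (by lia), Nat.mod_lt _ hE, ?_⟩
  have := Nat.div_add_mod' (p - 1) I.numE
  unfold vert copy
  lia

theorem vert_position {i m : ℕ} (hm : m < I.numE) : I.vert (1 + i * I.numE + m) = i := by
  unfold vert
  rw [show 1 + i * I.numE + m - 1 = m + i * I.numE by lia, Nat.add_mul_div_right _ _ (by lia),
    Nat.div_eq_of_lt hm, Nat.zero_add]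

theorem copy_position {i m : ℕ} (hm : m < I.numE) : I.copy (1 + i * I.numE + m) = m := by
  unfold copy
  rw [show 1 + i * I.numE + m - 1 = m + i * I.numE by lia, Nat.add_mul_mod_self_right,
    Nat.mod_eq_of_lt hm]

theorem position_lt {i m : ℕ} (hi : i < I.numV) (hm : m < I.numE) :
    1 + i * I.numE + m < I.string.length := by
  have := Nat.mul_le_mul_right I.numE hi
  rw [Nat.succ_mul] at this
  rw [length_string]
  lia

end VCInstance

/-! ### From dependency analyses to vertex covers -/

namespace VCInstance

variable {I : VCInstance}

/-- The heads in an analysis: `s` governs by its valencies, which are not empty only if `k ≠ 0`, and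
any other head has a reading `U_i` and is an occurrence of the same vertex as its modifier. -/
theorem gov_cases {T : Analysis I.string.length} (hT : T.Valid I.grammar I.string)
    {h m : Fin I.string.length} {d : ℕ} (hg : T.gov m = some (h, d)) :
    (I.k ≠ 0 ∧ h.val = 0 ∧
      ((∃ a < I.numV - I.k, d = depU a ∧
          ((T.reading m).name = clsU ∨ ∃ i, (T.reading m).name = clsUi i)) ∨
        (∃ j < I.numE, d = depH j ∧ (T.reading m).name = clsH j) ∨
        (∃ b < (I.k - 1) * I.numE, d = depR b ∧
          ((T.reading m).name = clsR ∨ ∃ i, (T.reading m).name = clsVi i)))) ∨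
    ∃ i, (T.reading h).name = clsUi i ∧ (T.reading m).name = clsVi i ∧
      I.string.get h = wordV i ∧ I.string.get m = wordV i := by
  obtain ⟨v, hv, rfl, hisa, -⟩ := hT.governs h d m hg
  obtain ⟨hc, hlex⟩ := hT.reading_mem h
  obtain ⟨-, hlex'⟩ := hT.reading_mem m
  rcases I.mem_classes.1 hc with
    hr | hr | hr | ⟨j, hj, hr⟩ | ⟨i, hi, hr⟩ | ⟨i, hi, hr⟩ <;> rw [hr] at hv hlex
  · left
    have hh : h.val = 0 := by
      by_contra hne
      rw [I.get_string hne] at hlex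
      rcases I.mem_lex.1 hlex with ⟨hw, -⟩ | ⟨i, -, -, hc⟩ | ⟨j, hj, hc, -⟩
      · simp [wordV, wordS] at hw
      · simp only [freeClass, clsS, clsUi, clsVi] at hc
        lia
      · simp only [freeClass, clsS, clsH] at hc
        lia
    obtain ⟨hk, hv⟩ := I.mem_valenciesS.1 hv
    refine ⟨hk, hh, ?_⟩
    rcases hv with ⟨a, ha, rfl⟩ | ⟨j, hj, rfl⟩ | ⟨b, hb, rfl⟩
    · refine .inl ⟨a, ha, rfl, ?_⟩
      rcases I.isa_iff.1 hisa with h | ⟨i, -, ⟨h, -⟩ | ⟨-, h⟩⟩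
      · exact .inl h
      · exact .inr ⟨i, h⟩
      · cases h
    · refine .inr (.inl ⟨j, hj, rfl, ?_⟩)
      rcases I.isa_iff.1 hisa with h | ⟨i, -, ⟨-, h⟩ | ⟨-, h⟩⟩
      · exact h
      · simp only [clsH, clsU] at h
        lia
      · simp only [clsH, clsR] at h
        lia
    · refine .inr (.inr ⟨b, hb, rfl, ?_⟩)
      rcases I.isa_iff.1 hisa with h | ⟨i, -, ⟨-, h⟩ | ⟨h, -⟩⟩
      · exact .inl h
      · cases h
      · exact .inr ⟨i, h⟩
  · cases hv
  · cases hv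
  · cases hv
  · right
    obtain ⟨b, -, rfl⟩ := I.mem_valenciesUi.1 hv
    have hm : (T.reading m).name = clsVi i := by
      rcases I.isa_iff.1 hisa with h | ⟨i, -, ⟨-, h⟩ | ⟨-, h⟩⟩
      · exact h
      · simp only [clsVi, clsU] at h
        lia
      · simp only [clsVi, clsR] at h
        lia
    refine ⟨i, by rw [hr]; rfl, hm, ?_, ?_⟩
    · rcases I.mem_lex.1 hlex with ⟨-, hc⟩ | ⟨i', -, hw, hc⟩ | ⟨j, hj, hc, -⟩
      · simp [freeClass, clsS, clsUi] at hc
      · obtain rfl : i = i' := by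
          simp only [freeClass, clsUi, clsVi] at hc
          lia
        exact hw
      · simp only [freeClass, clsUi, clsH] at hc
        lia
    · rw [hm] at hlex'
      rcases I.mem_lex.1 hlex' with ⟨-, hc⟩ | ⟨i', -, hw, hc⟩ | ⟨j, hj, hc, -⟩
      · simp [clsS, clsVi] at hc
      · obtain rfl : i = i' := by
          simp only [clsUi, clsVi] at hc
          lia
        exact hw
      · simp only [clsVi, clsH] at hc
        lia
  · cases hv

theorem gov_ne_none {T : Analysis I.string.length} (hT : T.Valid I.grammar I.string)
    {m : Fin I.string.length} (hm : m.val ≠ 0) : T.gov m ≠ none := by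
  have h0 : 0 < I.string.length := Nat.zero_lt_of_lt m.isLt
  -- The word `s` cannot have a head, so it is the root.
  have hs : T.gov ⟨0, h0⟩ = none := by
    by_contra hne
    obtain ⟨⟨h, d⟩, hg⟩ := Option.ne_none_iff_exists'.1 hne
    have hlex := (hT.reading_mem ⟨0, h0⟩).2
    rw [get_string_zero] at hlex
    have hname : (T.reading ⟨0, h0⟩).name = clsS := by
      rcases I.mem_lex.1 hlex with ⟨-, hc⟩ | ⟨i, -, hw, -⟩ | ⟨j, hj, -, hw⟩
      · exact hc
      · simp [wordS, wordV] at hw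
      · simp [wordS, wordV] at hw
    rcases gov_cases hT hg with
      ⟨-, -, ⟨a, -, -, hn | ⟨i, hn⟩⟩ | ⟨j, -, -, hn⟩ | ⟨b, -, -, hn | ⟨i, hn⟩⟩⟩ |
        ⟨i, -, hn, -⟩ <;>
    rw [hname] at hn <;> simp [clsS, clsU, clsUi, clsR, clsVi, clsH] at hn
  obtain ⟨r, hr, hreach⟩ := hT.tree
  have hroot : ∀ x, T.gov x = none → x = r := by
    intro x hx
    rcases (Relation.ReflTransGen.cases_tail_iff _ _ _).1 (hreach x) with h | ⟨y, -, d, hd⟩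
    · exact h
    · rw [hx] at hd
      cases hd
  intro hnone
  have := (hroot m hnone).trans (hroot _ hs).symm
  exact hm (congrArg Fin.val this)

/-- Some occurrence of the vertex `i` is governed by `s` in one of the dependencies `u_a`. -/
def IsSkipped (T : Analysis I.string.length) (i : ℕ) : Prop :=
  ∃ (a : ℕ) (s m : Fin I.string.length), a < I.numV - I.k ∧ s.val = 0 ∧
    T.gov m = some (s, depU a) ∧ I.string.get m = wordV i

/-- An occurrence of a vertex that is not skipped is governed by `s`, in a dependency `r_b` or in a
dependency `h_j` such that the vertex is an end point of the edge `e_j`. -/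
theorem isSkipped_or_gov {T : Analysis I.string.length} (hT : T.Valid I.grammar I.string)
    {m : Fin I.string.length} (hm : m.val ≠ 0) :
    I.k ≠ 0 ∧ (IsSkipped T (I.vert m) ∨ ∃ s d, T.gov m = some (s, d) ∧ s.val = 0 ∧
      ((∃ j, ∃ hj : j < I.numE, d = depH j ∧
        (I.vert m = (I.edges[j]'hj).1 ∨ I.vert m = (I.edges[j]'hj).2)) ∨
      ∃ b < (I.k - 1) * I.numE, d = depR b)) := by
  obtain ⟨⟨h, d⟩, hg⟩ := Option.ne_none_iff_exists'.1 (gov_ne_none hT hm)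
  have hlex := (hT.reading_mem m).2
  rw [I.get_string hm] at hlex
  rcases gov_cases hT hg with
    ⟨hk, h0, ⟨a, ha, rfl, -⟩ | ⟨j, hj, rfl, hn⟩ | ⟨b, hb, rfl, -⟩⟩ | ⟨i, hh, -, hw, hw'⟩
  · exact ⟨hk, .inl ⟨a, h, m, ha, h0, hg, I.get_string hm⟩⟩
  · refine ⟨hk, .inr ⟨h, _, hg, h0, .inl ⟨j, hj, rfl, ?_⟩⟩⟩
    rw [hn] at hlex
    rcases I.mem_lex.1 hlex with ⟨hw, -⟩ | ⟨i, -, -, hc⟩ | ⟨j', hj', hc, hw⟩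
    · simp [wordV, wordS] at hw
    · simp only [clsH, clsUi, clsVi] at hc
      lia
    · obtain rfl : j = j' := by
        simp only [clsH] at hc
        lia
      simpa [wordV] using hw
  · exact ⟨hk, .inr ⟨h, _, hg, h0, .inr ⟨b, hb, rfl⟩⟩⟩
  · -- The head of `m` has the reading `U_i` and is thus governed by `s` in some `u_a`.
    have hi' : I.vert m = i := by
      rw [I.get_string hm] at hw'
      simpa [wordV] using hw'
    have hh0 : h.val ≠ 0 := by
      intro h0
      have : h = ⟨0, Nat.zero_lt_of_lt h.isLt⟩ := Fin.ext h0
      rw [this, get_string_zero] at hw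
      simp [wordV, wordS] at hw
    obtain ⟨⟨h', d'⟩, hg'⟩ := Option.ne_none_iff_exists'.1 (gov_ne_none hT hh0)
    rcases gov_cases hT hg' with
      ⟨hk, h0', ⟨a, ha, rfl, -⟩ | ⟨j, -, -, hn⟩ | ⟨b, -, -, hn | ⟨i', hn⟩⟩⟩ | ⟨i', -, hn, -⟩
    · exact ⟨hk, .inl ⟨a, h', h, ha, h0', hg', hi' ▸ hw⟩⟩
    all_goals
      rw [hh] at hn
      simp only [clsUi, clsH, clsR, clsVi] at hn
      lia

theorem card_isSkipped_le {T : Analysis I.string.length} (hT : T.Valid I.grammar I.string)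
    (W : Finset ℕ) (hW : ∀ i ∈ W, IsSkipped T i) : W.card ≤ I.numV - I.k := by
  have : Nonempty (Fin I.string.length) := ⟨⟨0, by simp [length_string]⟩⟩
  choose! a s m ha hs hg hw using hW
  rw [← Finset.card_range (I.numV - I.k)]
  refine Finset.card_le_card_of_injOn a (fun i hi => by simpa using ha i hi) fun i hi i' hi' h => ?_
  have hss : s i = s i' := Fin.ext ((hs i hi).trans (hs i' hi').symm)
  have := hT.mod_unique (s i) (depU (a i)) (m i) (m i') (hg i hi) (by rw [hg i' hi', hss, h])
  have h' := hw i hi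
  rw [this, hw i' hi'] at h'
  simpa [wordV, eq_comm] using h'

theorem mem_VC_of_mem_language (h : I.string ∈ I.grammar.language) : I ∈ VC := by
  classical
  have : Nonempty (Fin I.string.length) := ⟨⟨0, by simp [length_string]⟩⟩
  obtain ⟨T, hT⟩ := h
  rcases Nat.eq_zero_or_pos I.numE with hE | hE
  · have : I.edges = [] := List.length_eq_zero_iff.1 hE
    exact ⟨∅, by simp, by simp, fun e => absurd e.2 (by simp [this]),
      fun e => absurd e.2 (by simp [this])⟩
  set W := (Finset.range I.numV).filter (IsSkipped T)
  set V' := (Finset.range I.numV).filter fun i => ¬ IsSkipped T i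
  have hW : W.card ≤ I.numV - I.k := card_isSkipped_le hT W fun i hi => (Finset.mem_filter.1 hi).2
  have hVW : W.card + V'.card = I.numV := by
    rw [Finset.card_filter_add_card_filter_not, Finset.card_range]
  have hk_lt := I.k_lt
  have hV' : I.k ≤ V'.card := by lia
  -- The edges one of whose end points is in `V'`.
  set J := (Finset.range I.numE).filter fun j =>
    ∃ i ∈ V', ∃ hj : j < I.numE, i = (I.edges[j]'hj).1 ∨ i = (I.edges[j]'hj).2
  have key : ∀ x ∈ V' ×ˢ Finset.range I.numE, ∃ (s m : Fin I.string.length) (d : ℕ),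
      m.val = 1 + x.1 * I.numE + x.2 ∧ T.gov m = some (s, d) ∧ s.val = 0 ∧
      d ∈ J.image depH ∪ (Finset.range ((I.k - 1) * I.numE)).image depR := by
    rintro ⟨i, c⟩ hx
    simp only [V', Finset.mem_product, Finset.mem_filter, Finset.mem_range] at hx
    obtain ⟨⟨hi, hskip⟩, hc⟩ := hx
    obtain ⟨s, d, hg, hs, hd⟩ := (isSkipped_or_gov hT
      (m := ⟨1 + i * I.numE + c, position_lt hi hc⟩) (by simp)).2.resolve_left
      (by rwa [vert_position hc])
    refine ⟨s, _, d, rfl, hg, hs, ?_⟩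
    rw [vert_position hc] at hd
    rcases hd with ⟨j, hj, rfl, h⟩ | ⟨b, hb, rfl⟩
    · exact Finset.mem_union_left _ (Finset.mem_image_of_mem _ (Finset.mem_filter.2
        ⟨Finset.mem_range.2 hj, i, Finset.mem_filter.2 ⟨Finset.mem_range.2 hi, hskip⟩, hj, h⟩))
    · exact Finset.mem_union_right _ (Finset.mem_image_of_mem _ (Finset.mem_range.2 hb))
  have hk : I.k ≠ 0 := (isSkipped_or_gov hT
    (m := ⟨1 + 0 * I.numE + 0, position_lt (by lia) hE⟩) (by simp)).1
  choose! s m d hm hg hs hd using key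
  have hle : V'.card * I.numE ≤ J.card + (I.k - 1) * I.numE := calc
    V'.card * I.numE = (V' ×ˢ Finset.range I.numE).card := by simp
    _ ≤ (J.image depH ∪ (Finset.range ((I.k - 1) * I.numE)).image depR).card := by
      refine Finset.card_le_card_of_injOn d hd ?_
      rintro ⟨i, c⟩ hx ⟨i', c'⟩ hx' h
      have hss : s (i, c) = s (i', c') := Fin.ext ((hs _ hx).trans (hs _ hx').symm)
      have hmm := congrArg Fin.val <| hT.mod_unique (s (i, c)) (d (i, c)) (m (i, c)) (m (i', c'))
        (hg _ hx) (by rw [hg _ hx', hss, h])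
      rw [hm _ hx, hm _ hx'] at hmm
      have hc := Finset.mem_range.1 (Finset.mem_product.1 hx).2
      have hc' := Finset.mem_range.1 (Finset.mem_product.1 hx').2
      dsimp only at hmm hc hc'
      have h1 := congrArg I.vert hmm
      have h2 := congrArg I.copy hmm
      rw [vert_position hc, vert_position hc'] at h1
      rw [copy_position hc, copy_position hc'] at h2
      rw [h1, h2]
    _ ≤ _ := (Finset.card_union_le _ _).trans
      (Nat.add_le_add Finset.card_image_le (Finset.card_image_le.trans (by simp)))
  have hkE : I.k * I.numE = I.numE + (I.k - 1) * I.numE := by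
    obtain ⟨k, hk⟩ := Nat.exists_eq_succ_of_ne_zero hk
    rw [hk, Nat.succ_sub_one, Nat.succ_mul, Nat.add_comm]
  have hJle : J.card ≤ I.numE := (Finset.card_filter_le _ _).trans (by simp)
  have hJ : J = Finset.range I.numE := by
    refine Finset.eq_of_subset_of_card_le (Finset.filter_subset _ _) ?_
    have := Nat.mul_le_mul_right I.numE hV'
    rw [Finset.card_range]
    lia
  have hcard : V'.card ≤ I.k := by
    refine Nat.le_of_mul_le_mul_right ?_ hE
    lia
  refine ⟨V', Finset.filter_subset _ _, hcard, ?_⟩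
  have hcov : ∀ e : {e // e ∈ I.edges}, ∃ v : {v // v ∈ V'}, (v : ℕ) = e.1.1 ∨ (v : ℕ) = e.1.2 := by
    rintro ⟨e, he⟩
    obtain ⟨j, hj, rfl⟩ := List.getElem_of_mem he
    have hjJ : j ∈ J := hJ ▸ Finset.mem_range.2 hj
    obtain ⟨-, i, hi, _, h⟩ := Finset.mem_filter.1 hjJ
    exact ⟨⟨i, hi⟩, h⟩
  choose f hf using hcov
  exact ⟨f, hf⟩

end VCInstance

/-! ### From vertex covers to dependency analyses -/

/-- The number of elements of `A` below `i`. -/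
def rank (A : Finset ℕ) (i : ℕ) : ℕ := (A.filter (· < i)).card

theorem rank_lt {A : Finset ℕ} {i : ℕ} (hi : i ∈ A) : rank A i < A.card :=
  Finset.card_lt_card ⟨Finset.filter_subset _ _, fun h => by simpa using h hi⟩

theorem rank_lt_rank {A : Finset ℕ} {i j : ℕ} (hi : i ∈ A) (h : i < j) : rank A i < rank A j := by
  refine Finset.card_lt_card ⟨fun x hx => ?_, fun hs => ?_⟩
  · simp only [Finset.mem_filter] at hx ⊢
    exact ⟨hx.1, hx.2.trans h⟩
  · simpa using hs (Finset.mem_filter.2 ⟨hi, h⟩)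

theorem rank_injOn (A : Finset ℕ) : Set.InjOn (rank A) A := by
  intro i hi j hj h
  by_contra hne
  rcases Nat.lt_or_gt_of_ne hne with hlt | hlt
  · exact (rank_lt_rank hi hlt).ne h
  · exact (rank_lt_rank hj hlt).ne h.symm

namespace VCInstance

variable {I : VCInstance}

/-- `V'` is a vertex cover of size exactly `k`, and `g j` is the vertex chosen for the edge with
index `j`. -/
structure IsCover (I : VCInstance) (V' : Finset ℕ) (g : ℕ → ℕ) : Prop where
  subset : V' ⊆ Finset.range I.numV
  card : V'.card = I.k
  mem : ∀ j < I.numE, g j ∈ V'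
  endpoint : ∀ j, ∀ hj : j < I.numE, g j = (I.edges[j]'hj).1 ∨ g j = (I.edges[j]'hj).2

theorem exists_isCover (h : I ∈ VC) : ∃ V' g, IsCover I V' g := by
  classical
  obtain ⟨V', hsub, hcard, f, hf⟩ := h
  obtain ⟨V'', h1, h2, h3⟩ := Finset.exists_subsuperset_card_eq hsub hcard
    (by simpa using I.k_lt.le)
  refine ⟨V'', fun j => if hj : j < I.numE then f ⟨I.edges[j]'hj, List.getElem_mem _⟩ else 0,
    h2, h3, fun j hj => ?_, fun j hj => ?_⟩
  · rw [dif_pos hj]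
    exact h1 (f _).2
  · rw [dif_pos hj]
    exact hf ⟨I.edges[j]'hj, List.getElem_mem _⟩

variable (I) (V' : Finset ℕ) (g : ℕ → ℕ)

/-- The reading of position `p`: the copy with number `j` of the vertex `g j` in the cover is read
as `H_j`, the other copies of vertices in the cover as `V_i`; the first copy of a vertex
outside the cover is read as `U_i`, its other copies as `V_i`. -/
def readingOf (p : ℕ) : WordClass :=
  if p = 0 then freeClass clsS I.valenciesS
  else if I.vert p ∈ V' then
    if g (I.copy p) = I.vert p then freeClass (clsH (I.copy p)) []
    else freeClass (clsVi (I.vert p)) []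
  else if I.copy p = 0 then freeClass (clsUi (I.vert p)) (I.valenciesUi (I.vert p))
  else freeClass (clsVi (I.vert p)) []

/-- The head of position `p ≠ 0`: the first copy of a vertex outside the cover governs the other
copies of this vertex, everything else is governed by `s`. -/
def headOf (p : ℕ) : ℕ := if I.vert p ∉ V' ∧ I.copy p ≠ 0 then p - I.copy p else 0

/-- The dependency of position `p ≠ 0` to its head. For the dependencies `r_b` of `s`, the
`(k - 1) * |E|` pairs of a copy number `j` and a vertex of the cover other than `g j` are
counted. -/
def depOf (p : ℕ) : ℕ :=
  if I.vert p ∈ V' then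
    if g (I.copy p) = I.vert p then depH (I.copy p)
    else depR (rank (V'.erase (g (I.copy p))) (I.vert p) * I.numE + I.copy p)
  else if I.copy p = 0 then depU (rank (Finset.range I.numV \ V') (I.vert p))
  else depR (I.copy p - 1)

theorem headOf_le (p : ℕ) : I.headOf V' p ≤ p := by
  unfold headOf
  split_ifs <;> lia

/-- The dependency analysis that belongs to a vertex cover of size `k`. -/
def analysis : Analysis I.string.length where
  reading p := I.readingOf V' g p
  gov p := if p.val = 0 then none
    else some (⟨I.headOf V' p, (I.headOf_le V' p).trans_lt p.isLt⟩, I.depOf V' g p)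
  selfDom _ := 0
  host p := ⟨I.headOf V' p, (I.headOf_le V' p).trans_lt p.isLt⟩
  hostDom _ := 0

variable {I V' g}

/-- A head other than `s` is the first copy of a vertex outside the cover. -/
theorem headOf_ne_zero {p : ℕ} (hlt : p < I.string.length) (h : I.headOf V' p ≠ 0) :
    I.vert p ∉ V' ∧ I.copy p ≠ 0 ∧ I.headOf V' p = 1 + I.vert p * I.numE ∧
      I.vert (I.headOf V' p) = I.vert p ∧ I.copy (I.headOf V' p) = 0 := by
  unfold headOf at h ⊢
  split_ifs at h ⊢ with hc
  · obtain ⟨-, hE, hp⟩ := position_spec (I := I) (p := p) (by lia) hlt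
    have hp' : p - I.copy p = 1 + I.vert p * I.numE + 0 := by lia
    rw [hp']
    exact ⟨hc.1, hc.2, rfl, vert_position (by lia), copy_position (by lia)⟩
  · exact absurd rfl h

/-- The dependency tree has depth at most two. -/
theorem headOf_headOf {p : ℕ} (hlt : p < I.string.length) (h : I.headOf V' p ≠ 0) :
    I.headOf V' (I.headOf V' p) = 0 := by
  have := headOf_ne_zero hlt h
  rw [headOf, if_neg]
  simp [this.2.2.2.2]

theorem IsCover.reading_mem (hc : IsCover I V' g) (p : Fin I.string.length) :
    I.readingOf V' g p ∈ I.grammar.classes ∧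
    (I.string.get p, (I.readingOf V' g p).name) ∈ I.grammar.lex := by
  rcases Nat.eq_zero_or_pos p.val with hp | hp
  · have : p = ⟨0, Nat.zero_lt_of_lt p.isLt⟩ := Fin.ext hp
    rw [this, get_string_zero, mem_classes, mem_lex]
    simp [readingOf, freeClass]
  · rw [I.get_string hp.ne', mem_classes, mem_lex]
    obtain ⟨hi, hm, -⟩ := position_spec hp.ne' p.isLt
    unfold readingOf
    rw [if_neg hp.ne']
    split_ifs with h1 h2 h3
    · refine ⟨.inr (.inr (.inr (.inl ⟨_, hm, rfl⟩))), .inr (.inr ⟨_, hm, rfl, ?_⟩)⟩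
      rcases hc.endpoint _ hm with h | h
      · exact .inl (by rw [← h, h2])
      · exact .inr (by rw [← h, h2])
    · exact ⟨.inr (.inr (.inr (.inr (.inr ⟨_, hi, rfl⟩)))), .inr (.inl ⟨_, hi, rfl, .inr rfl⟩)⟩
    · exact ⟨.inr (.inr (.inr (.inr (.inl ⟨_, hi, rfl⟩)))), .inr (.inl ⟨_, hi, rfl, .inl rfl⟩)⟩
    · exact ⟨.inr (.inr (.inr (.inr (.inr ⟨_, hi, rfl⟩)))), .inr (.inl ⟨_, hi, rfl, .inr rfl⟩)⟩

theorem IsCover.exists_valency (hc : IsCover I V' g) {p : ℕ} (hp : p ≠ 0)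
    (hlt : p < I.string.length) :
    ∃ v ∈ (I.readingOf V' g (I.headOf V' p)).valencies, v.dep = I.depOf V' g p ∧
      I.grammar.Isa (I.readingOf V' g p).name v.cls := by
  obtain ⟨hi, hm, -⟩ := position_spec hp hlt
  have hk : I.k ≠ 0 := by
    rw [← hc.card]
    exact (Finset.card_pos.2 ⟨_, hc.mem _ hm⟩).ne'
  have hS : (I.readingOf V' g 0).valencies = I.valenciesS := rfl
  by_cases h1 : I.vert p ∈ V'
  · have hh : I.headOf V' p = 0 := by simp [headOf, h1]
    rw [hh, hS]
    simp only [readingOf, if_neg hp, depOf, if_pos h1]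
    split_ifs with h2
    · exact ⟨_, I.mem_valenciesS.2 ⟨hk, .inr (.inl ⟨_, hm, rfl⟩)⟩, rfl, .refl⟩
    · refine ⟨_, I.mem_valenciesS.2 ⟨hk, .inr (.inr ⟨_, ?_, rfl⟩)⟩, rfl,
        I.isa_iff.2 (.inr ⟨_, hi, .inr ⟨rfl, rfl⟩⟩)⟩
      have := rank_lt (Finset.mem_erase.2 ⟨Ne.symm h2, h1⟩)
      rw [Finset.card_erase_of_mem (hc.mem _ hm), hc.card] at this
      have := Nat.mul_le_mul_right I.numE this
      rw [Nat.succ_mul] at this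
      lia
  · by_cases h3 : I.copy p = 0
    · have hh : I.headOf V' p = 0 := by simp [headOf, h3]
      rw [hh, hS]
      simp only [readingOf, if_neg hp, depOf, if_neg h1, if_pos h3]
      refine ⟨_, I.mem_valenciesS.2 ⟨hk, .inl ⟨_, ?_, rfl⟩⟩, rfl,
        I.isa_iff.2 (.inr ⟨_, hi, .inl ⟨rfl, rfl⟩⟩)⟩
      have := rank_lt (Finset.mem_sdiff.2 ⟨Finset.mem_range.2 hi, h1⟩)
      rwa [Finset.card_sdiff_of_subset hc.subset, Finset.card_range, hc.card] at this
    · have hh : I.headOf V' p ≠ 0 := by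
        rw [headOf, if_pos ⟨h1, h3⟩]
        have := position_spec hp hlt
        lia
      obtain ⟨-, -, -, h4, h5⟩ := headOf_ne_zero hlt hh
      simp only [readingOf, if_neg hp, if_neg hh, depOf, if_neg h1, if_neg h3, h4, if_pos h5]
      exact ⟨_, I.mem_valenciesUi.2 ⟨_, by lia, rfl⟩, rfl, .refl⟩

/-- No two modifiers of the same head have the same dependency name. -/
theorem eq_of_headOf_eq_of_depOf_eq {p q : ℕ} (hp : p ≠ 0) (hq : q ≠ 0)
    (hlp : p < I.string.length) (hlq : q < I.string.length)
    (hh : I.headOf V' p = I.headOf V' q) (hd : I.depOf V' g p = I.depOf V' g q) : p = q := by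
  obtain ⟨hi, hm, hp'⟩ := position_spec hp hlp
  obtain ⟨hi', hm', hq'⟩ := position_spec hq hlq
  suffices h : I.vert p = I.vert q ∧ I.copy p = I.copy q by rw [hp', hq', h.1, h.2]
  -- The four cases of `readingOf`, in its order.
  have cases (x : ℕ) : (I.vert x ∈ V' ∧ g (I.copy x) = I.vert x ∧ I.headOf V' x = 0 ∧
        I.depOf V' g x = 3 * I.copy x + 1) ∨
      (I.vert x ∈ V'.erase (g (I.copy x)) ∧ I.headOf V' x = 0 ∧ I.depOf V' g x =
        3 * (rank (V'.erase (g (I.copy x))) (I.vert x) * I.numE + I.copy x) + 2) ∨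
      (I.vert x ∉ V' ∧ I.copy x = 0 ∧ I.headOf V' x = 0 ∧
        I.depOf V' g x = 3 * rank (Finset.range I.numV \ V') (I.vert x)) ∨
      (I.copy x ≠ 0 ∧ I.headOf V' x = x - I.copy x ∧
        I.depOf V' g x = 3 * (I.copy x - 1) + 2) := by
    unfold headOf depOf depH depR depU
    by_cases h1 : I.vert x ∈ V'
    · by_cases h2 : g (I.copy x) = I.vert x
      · simp [h1, h2]
      · simp [h1, h2, Ne.symm h2]
    · by_cases h3 : I.copy x = 0 <;> simp [h1, h3]
  rcases cases p with ⟨-, a1, a2, a3⟩ | ⟨a1, a2, a3⟩ | ⟨a1, a2, a3, a4⟩ | ⟨a1, a2, a3⟩ <;>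
  rcases cases q with ⟨-, b1, b2, b3⟩ | ⟨b1, b2, b3⟩ | ⟨b1, b2, b3, b4⟩ | ⟨b1, b2, b3⟩ <;>
  try lia
  · have hcopy : I.copy p = I.copy q := by lia
    exact ⟨by rw [← a1, ← b1, hcopy], hcopy⟩
  · have h : I.copy p + rank (V'.erase (g (I.copy p))) (I.vert p) * I.numE =
        I.copy q + rank (V'.erase (g (I.copy q))) (I.vert q) * I.numE := by lia
    have hcopy : I.copy p = I.copy q := by
      have h' := congrArg (· % I.numE) h
      simpa [Nat.mod_eq_of_lt hm, Nat.mod_eq_of_lt hm'] using h'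
    rw [hcopy] at h a1
    have hr := Nat.eq_of_mul_eq_mul_right (Nat.zero_lt_of_lt hm) (Nat.add_left_cancel h)
    exact ⟨rank_injOn _ a1 b1 hr, hcopy⟩
  · exact ⟨rank_injOn (Finset.range I.numV \ V') (by simp [hi, a1]) (by simp [hi', b1]) (by lia),
      by lia⟩
  · have hcopy : I.copy p = I.copy q := by lia
    have h : I.vert p * I.numE = I.vert q * I.numE := by lia
    exact ⟨Nat.eq_of_mul_eq_mul_right (Nat.zero_lt_of_lt hm) h, hcopy⟩

/-- The domain of `s` is the whole string; the domain of another word consists of this word and its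
modifiers, which have no modifiers themselves. -/
theorem mem_domain {x y : Fin I.string.length} {j : ℕ} : y ∈ (I.analysis V' g).domain x j ↔
    j = 0 ∧ (x.val = 0 ∨ y = x ∨ y.val ≠ 0 ∧ I.headOf V' y = x) := by
  have hgov {m : Fin I.string.length} : (I.analysis V' g).gov m ≠ none ↔ m.val ≠ 0 := by
    simp [analysis]
  constructor
  · rintro (⟨rfl, rfl⟩ | ⟨m, hm, hh, rfl, hmy⟩)
    · exact ⟨rfl, .inr (.inl rfl)⟩
    · refine ⟨rfl, ?_⟩
      induction hmy with
      | refl => exact .inr (.inr ⟨hgov.1 hm, congrArg Fin.val hh⟩)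
      | @tail y z _ hyz ih =>
        obtain ⟨hz, hzy⟩ := hyz
        have hzy' : I.headOf V' z = y := congrArg Fin.val hzy
        rcases ih with h | rfl | ⟨h, h'⟩
        · exact .inl h
        · exact .inr (.inr ⟨hgov.1 hz, hzy'⟩)
        · left
          rw [← h', ← hzy']
          exact headOf_headOf z.isLt (by rwa [hzy'])
  · rintro ⟨rfl, h⟩
    by_cases hyx : y = x
    · exact .inl ⟨hyx, rfl⟩
    by_cases hh : y.val ≠ 0 ∧ I.headOf V' y = x
    · exact .inr ⟨y, hgov.2 hh.1, Fin.ext hh.2, rfl, .refl⟩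
    -- What remains is the case that `x` is `s` and `y` is not a modifier of `s`.
    have hx : x.val = 0 := by tauto
    have hy : y.val ≠ 0 := fun h => hyx (Fin.ext (h.trans hx.symm))
    have hy' : I.headOf V' y ≠ 0 := fun h => hh ⟨hy, h.trans hx.symm⟩
    refine .inr ⟨(I.analysis V' g).host y, hgov.2 hy', Fin.ext ?_, rfl,
      .single ⟨hgov.2 hy, rfl⟩⟩
    exact (headOf_headOf y.isLt hy').trans hx.symm

theorem IsCover.valid_analysis (hc : IsCover I V' g) :
    (I.analysis V' g).Valid I.grammar I.string where
  reading_mem := hc.reading_mem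
  tree := by
    have h0 : 0 < I.string.length := by simp [length_string]
    have hhead (m : Fin I.string.length) (hm : m.val ≠ 0) :
        (I.analysis V' g).Head ((I.analysis V' g).host m) m :=
      ⟨I.depOf V' g m, by simp [analysis, hm]⟩
    have hroot (m : Fin I.string.length) (hm : m.val = 0) : m = ⟨0, h0⟩ := Fin.ext hm
    refine ⟨⟨0, h0⟩, by simp [analysis], fun m => ?_⟩
    by_cases hm : m.val = 0
    · rw [hroot m hm]
    by_cases hm' : I.headOf V' m = 0
    · exact .single (hroot ((I.analysis V' g).host m) hm' ▸ hhead m hm)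
    · have h := hhead ((I.analysis V' g).host m) hm'
      rw [hroot ((I.analysis V' g).host ((I.analysis V' g).host m))
        (headOf_headOf m.isLt hm')] at h
      exact .tail (.single h) (hhead m hm)
  mod_unique h d m m' hm hm' := by
    by_cases h0 : m.val = 0
    · simp [analysis, h0] at hm
    by_cases h0' : m'.val = 0
    · simp [analysis, h0'] at hm'
    simp only [analysis, if_neg h0, if_neg h0', Option.some.injEq, Prod.mk.injEq] at hm hm'
    exact Fin.ext (eq_of_headOf_eq_of_depOf_eq h0 h0' m.isLt m'.isLt
      (congrArg Fin.val (hm.1.trans hm'.1.symm)) (hm.2.trans hm'.2.symm))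
  governs h d m hm := by
    by_cases h0 : m.val = 0
    · simp [analysis, h0] at hm
    simp only [analysis, if_neg h0, Option.some.injEq, Prod.mk.injEq] at hm
    obtain ⟨rfl, rfl⟩ := hm
    obtain ⟨v, hv, hdep, hisa⟩ := hc.exists_valency h0 m.isLt
    refine ⟨v, hv, hdep, hisa, .inl rfl, ?_⟩
    exact List.length_pos_iff.2 (I.wellFormed_grammar.domains_ne _ (hc.reading_mem _).1)
  order := by
    have hdom (x : Fin I.string.length) (j : ℕ) (D : DomainSpec)
        (hD : ((I.analysis V' g).reading x).domains[j]? = some D) : D = ⟨false, []⟩ := by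
      have hmem := List.mem_of_getElem? hD
      rcases I.mem_classes.1 (hc.reading_mem x).1 with
        h | h | h | ⟨i, _, h⟩ | ⟨i, _, h⟩ | ⟨i, _, h⟩ <;>
      simpa [analysis, h, freeClass] using hmem
    constructor
    · exact fun x => List.length_pos_iff.2 (I.wellFormed_grammar.domains_ne _ (hc.reading_mem x).1)
    · intro x i j hij y _ z hz
      have := (mem_domain.1 hz).1
      lia
    · intro x j y z w hy hw hyz hzw
      obtain ⟨rfl, hy'⟩ := mem_domain.1 hy
      refine mem_domain.2 ⟨rfl, ?_⟩
      have hw' := (mem_domain.1 hw).2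
      by_cases hx : x.val = 0
      · exact .inl hx
      -- Now `x` is not `s`, and its domain is the block of all copies of its vertex.
      have hyx : x ≤ y := by
        rcases hy' with h | rfl | ⟨-, h⟩
        · exact absurd h hx
        · exact le_rfl
        · exact Fin.le_def.2 (h ▸ I.headOf_le V' y)
      have hwx : w.val ≠ 0 ∧ I.headOf V' w = x := by
        rcases hw' with h | rfl | h
        · exact absurd h hx
        · exact absurd (hyz.trans hzw) (not_lt.2 hyx)
        · exact h
      obtain ⟨h1, -, h2, -, -⟩ := headOf_ne_zero w.isLt (by rw [hwx.2]; exact hx)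
      obtain ⟨-, hm, hwp⟩ := position_spec hwx.1 w.isLt
      have hyz' : y.val < z.val := hyz
      have hzw' : z.val < w.val := hzw
      have hyx' : x.val ≤ y.val := hyx
      rw [hwx.2] at h2
      have hz : z.val = 1 + I.vert w * I.numE + (z.val - x.val) := by lia
      have hlt : z.val - x.val < I.numE := by lia
      have hv : I.vert z = I.vert w := by rw [hz, vert_position hlt]
      have hcp : I.copy z = z.val - x.val := by
        conv_lhs => rw [hz]
        rw [copy_position hlt]
      refine .inr (.inr ⟨by lia, ?_⟩)
      rw [headOf, hv, hcp, if_pos ⟨h1, by lia⟩]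
      lia
    · intro x j D hD hs
      rw [hdom x j D hD] at hs
      cases hs
    · intro x j D hD p hp
      rw [hdom x j D hD] at hp
      cases hp

theorem mem_language_of_mem_VC (h : I ∈ VC) : I.string ∈ I.grammar.language := by
  obtain ⟨V', g, hc⟩ := exists_isCover h
  exact ⟨I.analysis V' g, hc.valid_analysis⟩

theorem mem_VC_iff_mem_DGR : I ∈ VC ↔ I.toDG ∈ DGR :=
  ⟨fun h => ⟨I.isPossible_toDG, mem_language_of_mem_VC h⟩, fun h => mem_VC_of_mem_language h.2⟩

end VCInstance

theorem mainTheorem2 :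
    Nonempty (Turing.TM2ComputableInPolyTime
      VCInstance.encode DGInstance.encode VCInstance.toDG) ∧
    ∀ I : VCInstance,
      I.toDG.IsPossible ∧
      I.toDG.grammar.OnlyContinuous ∧
      I.toDG.input = VCInstance.wordS ::
        (List.range I.numV).flatMap
          (fun i => List.replicate I.edges.length (VCInstance.wordV i)) ∧
      (I ∈ VC ↔ I.toDG ∈ DGR) := by
  refine ⟨⟨Prog.computableInPolyTime VCInstance.program VCInstance.exec_program⟩, fun I => ?_⟩
  exact ⟨I.isPossible_toDG, I.onlyContinuous_grammar, rfl, I.mem_VC_iff_mem_DGR⟩
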